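/- **Setting.** Consider the rank 3 complex tensor model with propagator $\delta_{p,p'}\,(\sum_{s=1}^3 a_s|p_s|+m)^{-1}$, whose vertices are: the three quartic vertices $\varphi^4$ obtained from $\varphi_{p_1p_2p_3}\bar\varphi_{p_{1'}p_2p_3}\varphi_{p_{1'}p_{2'}p_{3'}}\bar\varphi_{p_1p_{2'}p_{3'}}$ by choosing which of the three colours plays the role of colour $1$, the mass vertex $\bar\varphi\varphi$, and the wave-function vertices $\bar\varphi|p_s|\varphi$, $s=1,2,3$. Let $\mathcal G$ be a connected finite amputated Feynman graph (propagators join a $\varphi$ to a $\bar\varphi$) with $N_{\rm ext}>0$ external legs, $V_2$ mass vertices, $V'_{s;2}$ wave-function vertices of colour $s$, $L$ propagators and $F_{\rm int}$ closed faces (closed strand lines). Its divergence degree is $$\omega_d(\mathcal G)=-L+F_{\rm int}+\sum_{s=1}^3V'_{s;2}.$$ The colour extension $\mathcal G_{\rm color}$ has one 4-valent vertex for each leg of a vertex of $\mathcal G$ (four for each $\varphi^4$ vertex, two for each two-point vertex); its lines of colour $0$ are the propagators, an external leg being an open half-line of colour $0$, and its lines of colour $s=1,2,3$ join the legs of a vertex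 of $\mathcal G$ that share a strand of colour $s$. For each of the three cycles $(0abc)$ of the colours up to reversal, the pinched jacket $\widetilde J$ is the closed ribbon graph with the vertices and lines of $\mathcal G_{\rm color}$, the colours being arranged around the vertices in the order $(0abc)$ at each $\varphi$ and in the reverse order at each $\bar\varphi$, with every external half-line closed by joining its two border strands; $g_{\widetilde J}$ is its genus. The boundary graph $\partial\mathcal G$ is the 3-coloured ribbon graph whose vertices are the external legs and whose lines are the external (open) strands of $\mathcal G$; $g_{\partial\mathcal G}$ is its genus (summed over components, $2C-2g=V-E+F$) and $C_{\partial\mathcal G}$ is its number of connected components. **Statement.** One has $\omega_d(\mathcal G)\ge 0$ if and only if $\mathcal G$ belongs to one of the following four classes, in which $\omega_d(\mathcal G)$ has the value in the last column: | $N_{\rm ext}$ | $V_2$ | $g_{\partial\mathcal G}$ | $C_{\partial\mathcal G}-1$ | $\sum_{\widetilde J}g_{\widetilde J}$ | $\omega_d(\mathcal G)$ | |---|---|---|---|---|---| | 4 | 0 | 0 | 0 | 0 | 0 | | 2 | 0 | 0 | 0 | 0 | 1 | | 2 | 1 | 0 | 0 | 0 | 0 | | 2 | 0 | 0 | 0 |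 1 | 0 | In particular the boundary graph is then connected and planar. If $N_{\rm ext}\ge 6$, then $\omega_d(\mathcal G)<0$, i.e. $\mathcal G$ is convergent by power counting. -/

import Mathlib

open Equiv

/-- The number of orbits of the group generated by the permutations in `S`. -/
noncomputable def orbitCount {α : Type*} (S : Set (Perm α)) : ℕ :=
  Nat.card (MulAction.orbitRel.Quotient (Subgroup.closure S) α)

/-! ### Ribbon graphs -/

/-- An orientable ribbon graph on a set `D` of half-edges, every vertex being incident to at least
one half-edge. The cycles of `rot` are the vertices (with the cyclic order of the half-edges around
them). The two-element orbits of the involution `inv` are the edges. A half-edge fixed by `inv` is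
an external leg that has been pinched: the boundary walk of the surface that runs along one of its
sides goes around its end and comes back along the other side. -/
structure RibbonGraph (D : Type*) where
  rot : Perm D
  inv : Perm D
  inv_inv : ∀ d, inv (inv d) = d

namespace RibbonGraph

variable {D : Type*} (R : RibbonGraph D)

noncomputable def numVertices : ℕ := orbitCount {R.rot}

/-- The number of edges. Each edge consists of two half-edges; pinched legs are not edges. -/
noncomputable def numEdges : ℚ := (Nat.card {d : D // R.inv d ≠ d} : ℚ) / 2

/-- The number of closed boundary walks of the (pinched) ribbon graph. -/
noncomputable def numFaces : ℕ := orbitCount {R.rot * R.inv}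

noncomputable def numComponents : ℕ := orbitCount {R.rot, R.inv}

/-- The genus (the sum of the genera of the components), given by Euler's formula
`2 C - 2 g = V - E + F`. It is written in `ℚ` so that no truncation can occur. -/
noncomputable def genus : ℚ :=
  (2 * R.numComponents - (R.numVertices - R.numEdges + R.numFaces)) / 2

end RibbonGraph

/-! ### Feynman graphs of the rank three tensor model -/

/-- The interaction vertices. `quartic c` is the `φ⁴` vertex in which colour `c` is distinguished;
for the first colour it is
`φ_{1,2,3} φ̄_{1',2,3} φ_{1',2',3'} φ̄_{1,2',3'}`.
`mass` is the vertex `φ̄ φ`, and `wave s` is the vertex `φ̄ |p_s| φ`. -/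
inductive VertexKind where
  | quartic (c : Fin 3)
  | mass
  | wave (s : Fin 3)

namespace VertexKind

/-- The number of fields `φ` at the vertex, which is also the number of fields `φ̄`. -/
def pairs : VertexKind → ℕ
  | quartic _ => 2
  | mass => 1
  | wave _ => 1

/-- The index of the field to which the strand of colour `s` of the `i`-th field `φ` (or `φ̄`) runs
inside the vertex; that field is a `φ̄` (or `φ`). -/
def partner : (k : VertexKind) → Fin 3 → Fin k.pairs → Fin k.pairs
  | quartic c, s, i => if s = c then Fin.rev i else i
  | mass, _, i => i
  | wave _, _, i => i

theorem partner_partner (k : VertexKind) (s : Fin 3) (i : Fin k.pairs) :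
    k.partner s (k.partner s i) = i := by
  cases k with
  | quartic c => by_cases h : s = c <;> simp [partner, h]
  | mass => rfl
  | wave _ => rfl

end VertexKind

/-- The fields (legs) of the vertices: a vertex, a number, and `true` for `φ`, `false` for `φ̄`. -/
abbrev Leg {V : Type*} (kind : V → VertexKind) : Type _ :=
  Σ v : V, Fin (kind v).pairs × Bool

/-- An amputated Feynman graph with vertex set `V`. A propagator joins a field `φ` to a field `φ̄`:
`line l` is the other end of the propagator at `l`, and `line l = l` if `l` is an external leg. -/
structure TensorGraph (V : Type*) where
  kind : V → VertexKind
  line : Leg kind → Leg kind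
  line_line : ∀ l, line (line l) = l
  line_polarity : ∀ l, line l ≠ l → (line l).2.2 = !l.2.2

namespace TensorGraph

variable {V : Type*} (G : TensorGraph V)

/-- The graph `G` is connected (in particular it has a vertex). -/
def Connected : Prop :=
  (SimpleGraph.fromRel fun v w : V => ∃ l : Leg G.kind, l.1 = v ∧ (G.line l).1 = w).Connected

/-- The legs that are not contracted. -/
abbrev External : Type _ := {l : Leg G.kind // G.line l = l}

/-- `N_ext`. -/
noncomputable def numExternal : ℕ := Nat.card G.External

/-- `V_2`, the number of mass vertices. -/
noncomputable def numMass : ℕ := Nat.card {v : V // G.kind v = .mass}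

/-- `V'_{s;2}`, the number of wave function vertices of colour `s`. -/
noncomputable def numWave (s : Fin 3) : ℕ := Nat.card {v : V // G.kind v = .wave s}

/-- `L`, the number of propagators, each counted at its end `φ`. -/
noncomputable def numLines : ℕ := Nat.card {l : Leg G.kind // l.2.2 = true ∧ G.line l ≠ l}

/-- The propagators, as a permutation of the legs; it fixes the external legs. -/
def linePerm : Perm (Leg G.kind) := Function.Involutive.toPerm G.line G.line_line

/-- The other end of the strand of colour `s` that enters the vertex of `G` at the leg `l`. -/
def strand (s : Fin 3) (l : Leg G.kind) : Leg G.kind :=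
  ⟨l.1, (G.kind l.1).partner s l.2.1, !l.2.2⟩

theorem strand_strand (s : Fin 3) (l : Leg G.kind) : G.strand s (G.strand s l) = l := by
  simp [strand, VertexKind.partner_partner]

/-- The strands of colour `s` inside the vertices of `G`, as a permutation of the legs. -/
def strandPerm (s : Fin 3) : Perm (Leg G.kind) :=
  Function.Involutive.toPerm (G.strand s) (G.strand_strand s)

/-- The faces (open or closed strand lines) of colour `s`, made of the strands of colour `s` of the
vertices and of the propagators. -/
abbrev Face (s : Fin 3) : Type _ :=
  MulAction.orbitRel.Quotient (Subgroup.closure {G.linePerm, G.strandPerm s}) (Leg G.kind)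

/-- `F_int`, the number of closed faces: those that reach no external leg. -/
noncomputable def numInternalFaces : ℕ :=
  ∑ s : Fin 3, Nat.card {f : G.Face s // ∀ l : Leg G.kind, Quotient.mk'' l = f → G.line l ≠ l}

/-- The divergence degree `ω_d = - L + F_int + ∑ₛ V'_{s;2}`. -/
noncomputable def divergenceDegree : ℤ :=
  -(G.numLines : ℤ) + G.numInternalFaces + ∑ s : Fin 3, (G.numWave s : ℤ)

/-! ### Colour extension and pinched jackets -/

/-- The lines of the colour extension, whose vertices are the legs of `G` (four for each `φ⁴`
vertex and two for each `φ²` vertex). Colour `0` is carried by the propagators, and the lines of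
colours `1, 2, 3` replace the strands of the vertices. -/
def colorLine (i : Fin 4) : Perm (Leg G.kind) :=
  Fin.cons (α := fun _ => Perm (Leg G.kind)) G.linePerm G.strandPerm i

theorem colorLine_colorLine (i : Fin 4) (l : Leg G.kind) :
    G.colorLine i (G.colorLine i l) = l := by
  refine Fin.cases ?_ (fun s => ?_) i
  · exact G.line_line l
  · exact G.strand_strand s l

/-- The pinched jacket attached to a cycle `τ` of the four colours: the colours follow each other
around the vertices in the order `τ` at the `φ` vertices and in the reverse order at the `φ̄`
vertices. The external half-lines of colour `0` are pinched. -/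
def pinchedJacket (τ : Perm (Fin 4)) : RibbonGraph (Leg G.kind × Fin 4) where
  rot := Equiv.prodCongrRight fun l => if l.2.2 then τ else τ⁻¹
  inv := Equiv.prodCongrLeft G.colorLine
  inv_inv := fun d => Prod.ext (G.colorLine_colorLine d.2 d.1) rfl

/-- The three colour cycles `(0123)`, `(0132)`, `(0213)`, which represent all cycles of the four
colours up to reversal. -/
def jacketCycle : Fin 3 → Perm (Fin 4) := ![c[0, 1, 2, 3], c[0, 1, 3, 2], c[0, 2, 1, 3]]

/-- The sum of the genera of the three pinched jackets. -/
noncomputable def jacketGenusSum : ℚ := ∑ j : Fin 3, (G.pinchedJacket (jacketCycle j)).genus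

/-! ### The boundary graph -/

section Boundary

variable [Finite V]

theorem exists_return (s : Fin 3) (l : G.External) :
    ∃ k : ℕ, 0 < k ∧ G.line (((G.strandPerm s * G.linePerm) ^ k) l.1) =
      ((G.strandPerm s * G.linePerm) ^ k) l.1 :=
  ⟨orderOf (G.strandPerm s * G.linePerm), orderOf_pos _, by
    rw [pow_orderOf_eq_one]; exact l.2⟩

open Classical in
/-- The external leg at the other end of the strand of colour `s` that starts at the external leg
`l`: cross a vertex along colour `s`, then, unless an external leg is reached, follow the
propagator, cross the next vertex, and so on. -/
noncomputable def strandEnd (s : Fin 3) (l : G.External) : G.External :=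
  ⟨((G.strandPerm s * G.linePerm) ^ Nat.find (G.exists_return s l)) l.1,
    (Nat.find_spec (G.exists_return s l)).2⟩

theorem strandEnd_strandEnd (s : Fin 3) (l : G.External) :
    G.strandEnd s (G.strandEnd s l) = l := by
  classical
  set p := G.strandPerm s * G.linePerm with hp
  have hline : ∀ x, G.linePerm x = G.line x := fun _ => rfl
  have hl2 : G.linePerm * G.linePerm = 1 := Equiv.ext G.line_line
  have hs2 : G.strandPerm s * G.strandPerm s = 1 :=
    Equiv.ext (G.colorLine_colorLine s.succ)
  have hli : G.linePerm⁻¹ = G.linePerm := inv_eq_of_mul_eq_one_left hl2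
  have hsi : (G.strandPerm s)⁻¹ = G.strandPerm s := inv_eq_of_mul_eq_one_left hs2
  have hconj : G.linePerm * p * G.linePerm⁻¹ = p⁻¹ := by
    rw [hp, mul_inv_rev, hli, hsi, mul_assoc, mul_assoc, hl2, mul_one]
  have hpow : ∀ (k : ℕ) (x : Leg G.kind), G.line x = x →
      G.line ((p ^ k) x) = (p ^ k)⁻¹ x := by
    intro k x hx
    have h := congrArg (fun q => q ^ k) hconj
    simp only [conj_pow, inv_pow] at h
    rw [← h, hli, Perm.mul_apply, Perm.mul_apply, hline, hline, hx]
  set k := Nat.find (G.exists_return s l) with hk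
  have hspec := Nat.find_spec (G.exists_return s l)
  rw [← hk] at hspec
  have hu : (G.strandEnd s l).1 = (p ^ k) l.1 := rfl
  have hret : (p ^ k) (G.strandEnd s l).1 = l.1 := by
    have h := hpow k _ (G.strandEnd s l).2
    have h' : (p ^ k)⁻¹ ((p ^ k) l.1) = l.1 := by
      rw [← Perm.mul_apply, inv_mul_cancel, Perm.one_apply]
    rw [hu, h'] at h
    rw [hu, ← G.line_line ((p ^ k) ((p ^ k) l.1)), h, l.2]
  have hfind : Nat.find (G.exists_return s (G.strandEnd s l)) = k := by
    rw [Nat.find_eq_iff]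
    refine ⟨⟨hspec.1, ?_⟩, ?_⟩
    · rw [← hp, hret]; exact l.2
    · rintro j hj ⟨hj0, hjE⟩
      rw [← hp] at hjE
      have h := hpow j _ (G.strandEnd s l).2
      rw [hjE] at h
      have h2 : (p ^ j)⁻¹ (G.strandEnd s l).1 = (p ^ (k - j)) l.1 := by
        rw [hu, Perm.inv_eq_iff_eq, ← Perm.mul_apply, ← pow_add, Nat.add_sub_cancel' hj.le]
      refine Nat.find_min (G.exists_return s l) (m := k - j) (by omega) ⟨by omega, ?_⟩
      rw [← hp, ← h2, ← h]; exact hjE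
  apply Subtype.ext
  change (p ^ Nat.find (G.exists_return s (G.strandEnd s l))) (G.strandEnd s l).1 = l.1
  rw [hfind, hret]

/-- The boundary graph: its vertices are the external legs, its lines are the external strands, and
the colours follow each other in the order `1, 2, 3` around the legs `φ` and in the reverse order
around the legs `φ̄`. -/
noncomputable def boundary : RibbonGraph (G.External × Fin 3) where
  rot := Equiv.prodCongrRight fun l => if l.1.2.2 then finRotate 3 else (finRotate 3)⁻¹
  inv := Equiv.prodCongrLeft fun s =>
    Function.Involutive.toPerm (G.strandEnd s) (G.strandEnd_strandEnd s)
  inv_inv := fun d => Prod.ext (G.strandEnd_strandEnd d.2 d.1) rfl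

/-- The values of `N_ext`, `V_2`, `g_∂`, `C_∂ - 1` and `∑ g_J̃` of the graph. -/
def HasData (next v₂ : ℕ) (g c : ℚ) (gj : ℚ) : Prop :=
  G.numExternal = next ∧ G.numMass = v₂ ∧ G.boundary.genus = g ∧
    (G.boundary.numComponents : ℚ) - 1 = c ∧ G.jacketGenusSum = gj

end Boundary

end TensorGraph

/-! The proof rests on an exact formula for the divergence degree and on an upper bound for the
number of closed faces.

The formula is `ω = 3 - ∑ g_J̃ - N_ext / 2 - V_2 - C_∂ + g_∂` (`divergenceDegree_eq`). Bicoloured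
faces of a jacket that avoid colour `0` close inside the vertices. The others are strand lines of
two colours glued at the external legs: closed faces of `G`, or faces of the boundary graph
(`jacket_corner_count`). Summing Euler's formula over the three jackets produces `2 F_int` and all
faces of the boundary graph; Euler's formula for the latter trades them for `C_∂` and `g_∂`.

The formula alone does not control `g_∂`. The missing inequality is `F_int + C_∂ ≤ 1 + 2 (L - V +
1)`, where `V` is the number of vertices (`classCount_glueRel_le`). Its left side counts the strand
lines of all colours once glued at the external legs. For a function on these lines, the difference
of its values in two colours is a conserved current along the propagators. If this current vanishes
outside a spanning tree, it vanishes everywhere; the function then does not see the colours and is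
constant by connectedness. Two linear conditions per propagator outside the tree therefore leave
only the constants.

Hence `ω ≤ 3 - N_ext / 2 - C_∂ - V_2`. As `N_ext` is even and positive and `C_∂ ≥ 1`, a divergent
graph has two or four external legs. So small a boundary graph is planar, and the formula gives the
table. -/

/-! ### Counting classes of generated equivalence relations -/

/-- The number of classes of the equivalence relation generated by `r`. -/
noncomputable def classCount {α : Type*} (r : α → α → Prop) : ℕ := Nat.card (Quot r)

/-- The relation that links a point to its images under the permutations in `S`. -/
def moveRel {α : Type*} (S : Set (Perm α)) (x y : α) : Prop := ∃ g ∈ S, g x = y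

theorem quot_mk_eq_of_mem_closure {α : Type*} {S : Set (Perm α)} {g : Perm α}
    (hg : g ∈ Subgroup.closure S) (x : α) : Quot.mk (moveRel S) (g x) = Quot.mk (moveRel S) x := by
  induction hg using Subgroup.closure_induction generalizing x with
  | mem g hg => exact (Quot.sound ⟨g, hg, rfl⟩).symm
  | one => rfl
  | mul g h _ _ ihg ihh => rw [Perm.mul_apply, ihg, ihh]
  | inv g _ ih => rw [← ih (g⁻¹ x), ← Perm.mul_apply, mul_inv_cancel, Perm.one_apply]

/-- The orbits of the group generated by `S` are the classes of `moveRel S`. -/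
def orbitQuotientEquiv {α : Type*} (S : Set (Perm α)) :
    MulAction.orbitRel.Quotient (Subgroup.closure S) α ≃ Quot (moveRel S) where
  toFun := Quotient.lift (Quot.mk (moveRel S)) (by
    rintro a b ⟨⟨g, hg⟩, rfl⟩
    exact quot_mk_eq_of_mem_closure hg b)
  invFun := Quot.lift (fun x => Quotient.mk'' x) (by
    rintro a b ⟨g, hg, rfl⟩
    refine Quotient.sound' ⟨⟨g⁻¹, inv_mem (Subgroup.subset_closure hg)⟩, ?_⟩
    exact by simp)
  left_inv := by rintro ⟨x⟩; rfl
  right_inv := by rintro ⟨x⟩; rfl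

theorem orbitCount_eq_classCount {α : Type*} (S : Set (Perm α)) :
    orbitCount S = classCount (moveRel S) :=
  Nat.card_congr (orbitQuotientEquiv S)

theorem classCount_congr {α β : Type*} {r : α → α → Prop} {r' : β → β → Prop} (f : α → β)
    (g : β → α) (hf : ∀ a b, r a b → Quot.mk r' (f a) = Quot.mk r' (f b))
    (hg : ∀ a b, r' a b → Quot.mk r (g a) = Quot.mk r (g b))
    (hgf : ∀ a, Quot.mk r (g (f a)) = Quot.mk r a)
    (hfg : ∀ b, Quot.mk r' (f (g b)) = Quot.mk r' b) : classCount r = classCount r' :=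
  Nat.card_congr
    { toFun := Quot.lift (fun a => Quot.mk r' (f a)) hf
      invFun := Quot.lift (fun b => Quot.mk r (g b)) hg
      left_inv := by rintro ⟨a⟩; exact hgf a
      right_inv := by rintro ⟨b⟩; exact hfg b }

theorem classCount_congr_rel {α : Type*} {r r' : α → α → Prop}
    (h : ∀ a b, r a b → Quot.mk r' a = Quot.mk r' b)
    (h' : ∀ a b, r' a b → Quot.mk r a = Quot.mk r b) : classCount r = classCount r' :=
  classCount_congr id id h h' (fun _ => rfl) (fun _ => rfl)

/-- If the relation preserves the fibres of `b`, its classes can be counted fibre by fibre. -/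
theorem classCount_eq_sum_fiber {α B : Type*} [Finite α] [Fintype B] {r : α → α → Prop} (b : α → B)
    (h : ∀ x y, r x y → b x = b y) :
    classCount r = ∑ i, classCount fun x y : {x // b x = i} => r x y := by
  simp only [classCount]
  rw [← Nat.card_sigma]
  exact Nat.card_congr
    { toFun := Quot.lift (fun a => ⟨b a, Quot.mk _ ⟨a, rfl⟩⟩) (by
        intro x y hxy
        have : ∀ i (hi : b y = i), (⟨b y, Quot.mk _ ⟨y, rfl⟩⟩ :
            Σ i, Quot fun x y : {x // b x = i} => r x y) = ⟨i, Quot.mk _ ⟨y, hi⟩⟩ := by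
          rintro _ rfl; rfl
        rw [this _ (h x y hxy).symm]
        congr 1
        exact Quot.sound hxy)
      invFun := fun q => Quot.lift (fun x : {x // b x = q.1} => Quot.mk r x.1) (fun x y hxy => Quot.sound hxy) q.2
      left_inv := by rintro ⟨a⟩; rfl
      right_inv := by rintro ⟨i, ⟨⟨a, rfl⟩⟩⟩; rfl }

theorem classCount_eq_one {α : Type*} {r : α → α → Prop} (a : α)
    (h : ∀ x, Quot.mk r x = Quot.mk r a) : classCount r = 1 := by
  rw [classCount, Nat.card_eq_one_iff_unique]
  refine ⟨⟨?_⟩, ⟨Quot.mk r a⟩⟩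
  rintro ⟨x⟩ ⟨y⟩
  rw [h x, h y]

theorem classCount_pos {α : Type*} [Finite α] (r : α → α → Prop) (a : α) : 0 < classCount r := by
  have : Nonempty (Quot r) := ⟨Quot.mk r a⟩
  exact Nat.card_pos

theorem perm_apply_inv {α : Type*} (g : Perm α) (x : α) : g (g⁻¹ x) = x := by
  rw [← Perm.mul_apply, mul_inv_cancel, Perm.one_apply]

/-! ### Coloured graphs with polarities -/

/-- The ribbon graph of a set of vertices with lines `line c` for each colour `c`; the colours are
in the order `τ` at the vertices of positive polarity, in the reverse order at the others. -/
def coloredRibbon {X C : Type*} (pol : X → Bool) (line : C → Perm X)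
    (line_line : ∀ c x, line c (line c x) = x) (τ : Perm C) : RibbonGraph (X × C) where
  rot := Equiv.prodCongrRight fun x => if pol x then τ else τ⁻¹
  inv := Equiv.prodCongrLeft line
  inv_inv := fun d => Prod.ext (line_line d.2 d.1) rfl

section Colored

variable {X C : Type*} {pol : X → Bool} {line : C → Perm X}
  {line_line : ∀ c x, line c (line c x) = x} {τ : Perm C}

/-- `hτ` says that `τ` is a single cycle, in a form suited to quotients: the colours whose
half-edges at `x` lie in a given class form a `τ`-stable set. -/
theorem coloredRibbon_numVertices [Nonempty C]
    (hτ : ∀ T : Set C, T.Nonempty → (∀ c, c ∈ T ↔ τ c ∈ T) → T = Set.univ) :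
    (coloredRibbon pol line line_line τ).numVertices = Nat.card X := by
  obtain ⟨c₀⟩ := ‹Nonempty C›
  rw [RibbonGraph.numVertices, orbitCount_eq_classCount]
  set R := coloredRibbon pol line line_line τ
  have hstep : ∀ x c, Quot.mk (moveRel {R.rot}) (x, τ c) = Quot.mk (moveRel {R.rot}) (x, c) := by
    intro x c
    by_cases hx : pol x
    · exact (Quot.sound ⟨R.rot, rfl, by simp [R, coloredRibbon, hx]⟩).symm
    · exact Quot.sound ⟨R.rot, rfl, by simp [R, coloredRibbon, hx]⟩
  have hall : ∀ x c, Quot.mk (moveRel {R.rot}) (x, c) = Quot.mk (moveRel {R.rot}) (x, c₀) := by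
    intro x c
    have := hτ {c | Quot.mk (moveRel {R.rot}) (x, c) = Quot.mk (moveRel {R.rot}) (x, c₀)}
      ⟨c₀, rfl⟩ (fun c => by simp only [Set.mem_ofPred_eq, hstep])
    exact this.ge (Set.mem_univ c)
  refine Nat.card_congr
    { toFun := Quot.lift Prod.fst ?_
      invFun := fun x => Quot.mk _ (x, c₀)
      left_inv := ?_
      right_inv := fun x => rfl }
  · rintro ⟨x, c⟩ _ ⟨_, rfl, rfl⟩
    rfl
  · rintro ⟨x, c⟩
    exact (hall x c).symm

theorem coloredRibbon_numComponents [Nonempty C]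
    (hτ : ∀ T : Set C, T.Nonempty → (∀ c, c ∈ T ↔ τ c ∈ T) → T = Set.univ) :
    (coloredRibbon pol line line_line τ).numComponents =
      classCount fun x y => ∃ c, line c x = y := by
  obtain ⟨c₀⟩ := ‹Nonempty C›
  rw [RibbonGraph.numComponents, orbitCount_eq_classCount]
  set R := coloredRibbon pol line line_line τ
  set r := moveRel {R.rot, R.inv}
  have hstep : ∀ x c, Quot.mk r (x, τ c) = Quot.mk r (x, c) := by
    intro x c
    by_cases hx : pol x
    · exact (Quot.sound ⟨R.rot, .inl rfl, by simp [R, coloredRibbon, hx]⟩).symm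
    · exact Quot.sound ⟨R.rot, .inl rfl, by simp [R, coloredRibbon, hx]⟩
  have hall : ∀ x c c', Quot.mk r (x, c) = Quot.mk r (x, c') := by
    intro x c c'
    have := hτ {c | Quot.mk r (x, c) = Quot.mk r (x, c')}
      ⟨c', rfl⟩ (fun c => by simp only [Set.mem_ofPred_eq, hstep])
    exact this.ge (Set.mem_univ c)
  refine classCount_congr Prod.fst (fun x => (x, c₀)) ?_ ?_ (fun _ => hall _ _ _) (fun _ => rfl)
  · rintro ⟨x, c⟩ _ ⟨_, rfl | rfl, rfl⟩
    · rfl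
    · exact Quot.sound ⟨c, rfl⟩
  · rintro x _ ⟨c, rfl⟩
    rw [hall x c₀ c, hall _ c₀ c]
    exact Quot.sound ⟨R.inv, .inr rfl, rfl⟩

/-- Faces of a coloured ribbon graph, as classes of corners: the corner `(x, i)` lies between the
lines of colours `i` and `τ i` at `x`. -/
inductive CornerRel (line : C → Perm X) (τ : Perm C) : X × C → X × C → Prop
  | left (x : X) (i : C) : CornerRel line τ (x, i) (line i x, i)
  | right (x : X) (i : C) : CornerRel line τ (x, i) (line (τ i) x, i)
  | pinch (x : X) (i : C) (h : line (τ i) x = x) : CornerRel line τ (x, i) (x, τ i)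

/-- Each half-edge corresponds to the corner preceding it in the rotation. A line that is not
pinched reverses the polarity, hence the cyclic order, so the face keeps its colour pair `i`, `τ i`.
At a pinch the walk passes to the corner on the other side of the line. -/
theorem coloredRibbon_numFaces (hpol : ∀ c x, line c x ≠ x → pol (line c x) = !pol x) :
    (coloredRibbon pol line line_line τ).numFaces = classCount (CornerRel line τ) := by
  rw [RibbonGraph.numFaces, orbitCount_eq_classCount]
  set R := coloredRibbon pol line line_line τ
  set r := moveRel {R.rot * R.inv}
  have hsucc : ∀ x c, Quot.mk r (x, c) =
      Quot.mk r (line c x, if pol (line c x) then τ c else τ⁻¹ c) := by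
    intro x c
    refine Quot.sound ⟨_, rfl, ?_⟩
    by_cases h : pol (line c x) <;> simp [R, coloredRibbon, h]
  let g : X × C → X × C := fun d => (d.1, if pol d.1 then τ d.2 else d.2)
  have hleft : ∀ x i, Quot.mk r (g (x, i)) = Quot.mk r (g (line i x, i)) := by
    intro x i
    by_cases hfix : line i x = x
    · rw [hfix]
    have hp := hpol i x hfix
    by_cases hx : pol x
    · simp only [hx, Bool.not_true] at hp
      simp only [g, hx, hp, if_true, Bool.false_eq_true, if_false]
      rw [hsucc (line i x) i]
      simp [line_line, hx]
    · simp only [hx, Bool.not_false] at hp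
      simp only [g, hx, hp, if_true, Bool.false_eq_true, if_false]
      rw [hsucc x i]
      simp [hp]
  have hright : ∀ x i, Quot.mk r (g (x, i)) = Quot.mk r (g (line (τ i) x, i)) := by
    intro x i
    by_cases hfix : line (τ i) x = x
    · rw [hfix]
    have hp := hpol (τ i) x hfix
    by_cases hx : pol x
    · simp only [hx, Bool.not_true] at hp
      simp only [g, hx, hp, if_true, Bool.false_eq_true, if_false]
      rw [hsucc x (τ i)]
      simp [hp]
    · simp only [hx, Bool.not_false] at hp
      simp only [g, hx, hp, if_true, Bool.false_eq_true, if_false]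
      rw [hsucc (line (τ i) x) (τ i)]
      simp [line_line, hx]
  have hcorner : ∀ x c, Quot.mk (CornerRel line τ) (x, if pol x then τ⁻¹ c else c) =
      Quot.mk (CornerRel line τ) (line c x, if pol x then τ⁻¹ c else c) := by
    intro x c
    by_cases hx : pol x
    · have := CornerRel.right (line := line) (τ := τ) x (τ⁻¹ c)
      rw [perm_apply_inv] at this
      simpa [hx] using Quot.sound this
    · simpa [hx] using Quot.sound (CornerRel.left (line := line) (τ := τ) x c)
  refine classCount_congr (fun d => (d.1, if pol d.1 then τ⁻¹ d.2 else d.2)) g ?_ ?_ ?_ ?_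
  · rintro ⟨x, c⟩ _ ⟨_, rfl, rfl⟩
    have hR : (R.rot * R.inv) (x, c) =
        (line c x, if pol (line c x) then τ c else τ⁻¹ c) := by
      by_cases h : pol (line c x) <;> simp [R, coloredRibbon, h]
    rw [hR]
    dsimp only
    by_cases hfix : line c x = x
    · rw [hfix]
      have hpinch := CornerRel.pinch (line := line) (τ := τ) x (τ⁻¹ c)
        (by rw [perm_apply_inv, hfix])
      rw [perm_apply_inv] at hpinch
      by_cases hx : pol x
      · simpa [hx] using Quot.sound hpinch
      · simpa [hx] using (Quot.sound hpinch).symm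
    · rw [hcorner x c, hpol c x hfix]
      by_cases hx : pol x <;> simp [hx]
  · rintro _ _ (⟨x, i⟩ | ⟨x, i⟩ | ⟨x, i, h⟩)
    · exact hleft x i
    · exact hright x i
    · by_cases hx : pol x
      · have := hsucc x (τ i)
        rw [h] at this
        simpa [g, hx] using this
      · have := hsucc x (τ i)
        rw [h] at this
        simpa [g, hx] using this.symm
  · rintro ⟨x, c⟩
    by_cases hx : pol x <;> simp [g, hx]
  · rintro ⟨x, c⟩
    by_cases hx : pol x <;> simp [g, hx]

end Colored

namespace TensorGraph

variable {V : Type*} (G : TensorGraph V)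

/-! ### External strands -/

section Strands

theorem linePerm_apply (l : Leg G.kind) : G.linePerm l = G.line l := rfl

theorem strandPerm_apply (s : Fin 3) (l : Leg G.kind) : G.strandPerm s l = G.strand s l := rfl

theorem linePerm_inv : G.linePerm⁻¹ = G.linePerm :=
  inv_eq_of_mul_eq_one_left (Equiv.ext G.line_line)

theorem strandPerm_inv (s : Fin 3) : (G.strandPerm s)⁻¹ = G.strandPerm s :=
  inv_eq_of_mul_eq_one_left (Equiv.ext (G.strand_strand s))

/-- The two involutions generate a dihedral group with rotation `strandPerm s * linePerm`; faces can
thus be followed by powers of this rotation. -/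
theorem strandPerm_conj (s : Fin 3) :
    G.linePerm * (G.strandPerm s * G.linePerm) * G.linePerm⁻¹ =
      (G.strandPerm s * G.linePerm)⁻¹ := by
  rw [mul_inv_rev, G.strandPerm_inv, mul_assoc, mul_assoc, mul_inv_cancel, mul_one,
    G.linePerm_inv]

theorem line_zpow (s : Fin 3) (j : ℤ) {x : Leg G.kind} (hx : G.line x = x) :
    G.line (((G.strandPerm s * G.linePerm) ^ j) x) =
      ((G.strandPerm s * G.linePerm) ^ (-j)) x := by
  have h := congrArg (fun q => q ^ j) (G.strandPerm_conj s)
  simp only [conj_zpow, inv_zpow] at h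
  rw [zpow_neg, ← h, G.linePerm_inv, Perm.mul_apply, Perm.mul_apply, G.linePerm_apply,
    G.linePerm_apply, hx]

theorem strand_zpow (s : Fin 3) (j : ℤ) {x : Leg G.kind} (hx : G.line x = x) :
    G.strand s (((G.strandPerm s * G.linePerm) ^ j) x) =
      ((G.strandPerm s * G.linePerm) ^ (1 - j)) x := by
  rw [sub_eq_add_neg, zpow_add, zpow_one, Perm.mul_apply, ← G.line_zpow s j hx, Perm.mul_apply,
    G.linePerm_apply, G.line_line]
  rfl

theorem face_mk_line (s : Fin 3) (x : Leg G.kind) :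
    (Quotient.mk'' (G.line x) : G.Face s) = Quotient.mk'' x :=
  (orbitQuotientEquiv _).injective
    (Quot.sound ⟨G.linePerm, .inl rfl, rfl⟩ : Quot.mk (moveRel _) x = Quot.mk _ (G.line x)).symm

theorem face_mk_strand (s : Fin 3) (x : Leg G.kind) :
    (Quotient.mk'' (G.strand s x) : G.Face s) = Quotient.mk'' x :=
  (orbitQuotientEquiv _).injective
    (Quot.sound ⟨G.strandPerm s, .inr rfl, rfl⟩ :
      Quot.mk (moveRel _) x = Quot.mk _ (G.strand s x)).symm

theorem eq_of_face_eq {β : Sort*} {s : Fin 3} (f : Leg G.kind → β)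
    (hline : ∀ x, f (G.line x) = f x) (hstrand : ∀ x, f (G.strand s x) = f x)
    {x y : Leg G.kind} (h : (Quotient.mk'' x : G.Face s) = Quotient.mk'' y) : f x = f y := by
  have h' : Quot.mk (moveRel {G.linePerm, G.strandPerm s}) x = Quot.mk _ y :=
    congrArg (orbitQuotientEquiv _) h
  refine congrArg (Quot.lift f ?_) h'
  rintro a _ ⟨_, rfl | rfl, rfl⟩
  · exact (hline a).symm
  · exact (hstrand a).symm

variable [Finite V]

theorem strandEnd_face (s : Fin 3) (e : G.External) :
    (Quotient.mk'' (G.strandEnd s e).1 : G.Face s) = Quotient.mk'' e.1 := by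
  classical
  have : ∀ k : ℕ, (Quotient.mk'' (((G.strandPerm s * G.linePerm) ^ k) e.1) : G.Face s) =
      Quotient.mk'' e.1 := by
    intro k
    induction k with
    | zero => rfl
    | succ k ih =>
      rw [pow_succ', Perm.mul_apply, Perm.mul_apply, strandPerm_apply, linePerm_apply,
        face_mk_strand, face_mk_line, ih]
  exact this _

/-- Removing the first return from the walk replaces `e` by `strandEnd s e`; since `strandEnd` is an
involution, the induction hypothesis gives the same two alternatives, swapped. -/
theorem pow_external (s : Fin 3) (j : ℕ) (e e' : G.External)
    (h : e'.1 = ((G.strandPerm s * G.linePerm) ^ j) e.1) : e' = e ∨ e' = G.strandEnd s e := by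
  classical
  induction j using Nat.strong_induction_on generalizing e with
  | _ j ih =>
    rcases Nat.eq_zero_or_pos j with rfl | hj
    · exact .inl (Subtype.ext h)
    have hE : G.line (((G.strandPerm s * G.linePerm) ^ j) e.1) =
        ((G.strandPerm s * G.linePerm) ^ j) e.1 := h ▸ e'.2
    have hle : Nat.find (G.exists_return s e) ≤ j := Nat.find_min' _ ⟨hj, hE⟩
    have hpos := (Nat.find_spec (G.exists_return s e)).1
    have hu : (G.strandEnd s e).1 =
        ((G.strandPerm s * G.linePerm) ^ Nat.find (G.exists_return s e)) e.1 := rfl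
    have := ih (j - Nat.find (G.exists_return s e)) (by omega) (G.strandEnd s e) (by
      rw [hu, ← Perm.mul_apply, ← pow_add, Nat.sub_add_cancel hle, h])
    rw [strandEnd_strandEnd] at this
    exact this.symm

/-- An open strand line has no ends beyond these two: the images of `e` under the powers of the
rotation are stable under both involutions, so they fill the face. -/
theorem external_face_eq {s : Fin 3} {e e' : G.External}
    (h : (Quotient.mk'' e.1 : G.Face s) = Quotient.mk'' e'.1) : e' = e ∨ e' = G.strandEnd s e := by
  set p := G.strandPerm s * G.linePerm with hp
  have key := G.eq_of_face_eq (s := s) (fun x => ∃ j : ℤ, x = (p ^ j) e.1) ?_ ?_ h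
  · obtain ⟨j, hj⟩ := key.mp ⟨0, rfl⟩
    -- The rotation has finite order, so the integer power is also a natural one.
    have hmem : p ^ j ∈ Submonoid.powers p :=
      (isOfFinOrder_of_finite p).mem_powers_iff_mem_zpowers.mpr ⟨j, rfl⟩
    obtain ⟨k, hk⟩ := hmem
    refine G.pow_external s k e e' ?_
    rw [hj, ← hk]
  · have H : ∀ x, (∃ j : ℤ, x = (p ^ j) e.1) → ∃ j : ℤ, G.line x = (p ^ j) e.1 := by
      rintro _ ⟨j, rfl⟩
      exact ⟨-j, G.line_zpow s j e.2⟩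
    refine fun x => propext ⟨fun hx => ?_, H x⟩
    have := H _ hx
    rwa [G.line_line] at this
  · have H : ∀ x, (∃ j : ℤ, x = (p ^ j) e.1) → ∃ j : ℤ, G.strand s x = (p ^ j) e.1 := by
      rintro _ ⟨j, rfl⟩
      exact ⟨1 - j, G.strand_zpow s j e.2⟩
    refine fun x => propext ⟨fun hx => ?_, H x⟩
    have := H _ hx
    rwa [G.strand_strand] at this

/-- The first step flips the polarity once, because the external leg is fixed by `line`. Each later
step crosses a propagator and a strand, which flips it twice. -/
theorem strandEnd_polarity (s : Fin 3) (e : G.External) :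
    (G.strandEnd s e).1.2.2 = !e.1.2.2 := by
  classical
  set p := G.strandPerm s * G.linePerm with hp
  have H : ∀ j : ℕ, j < Nat.find (G.exists_return s e) →
      ((p ^ (j + 1)) e.1).2.2 = !e.1.2.2 := by
    intro j hj
    induction j with
    | zero =>
      rw [zero_add, pow_one, hp, Perm.mul_apply, linePerm_apply, e.2]
      rfl
    | succ j ih =>
      have hne : G.line ((p ^ (j + 1)) e.1) ≠ (p ^ (j + 1)) e.1 := fun h =>
        Nat.find_min (G.exists_return s e) hj ⟨j.succ_pos, h⟩
      have h1 := G.line_polarity _ hne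
      rw [ih (by omega), Bool.not_not] at h1
      rw [pow_succ', Perm.mul_apply]
      change (!(G.line ((p ^ (j + 1)) e.1)).2.2) = _
      rw [h1]
  have hpos := (Nat.find_spec (G.exists_return s e)).1
  have := H (Nat.find (G.exists_return s e) - 1) (by omega)
  rwa [Nat.sub_add_cancel hpos] at this

end Strands

/-! ### Gluing faces along external legs -/

/-- The strand lines of the colours `s i`, glued along the external legs. -/
inductive GlueRel {I : Type*} (s : I → Fin 3) : Leg G.kind × I → Leg G.kind × I → Prop
  | line (x : Leg G.kind) (i : I) : GlueRel s (x, i) (G.line x, i)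
  | strand (x : Leg G.kind) (i : I) : GlueRel s (x, i) (G.strand (s i) x, i)
  | glue (x : Leg G.kind) (i j : I) (h : G.line x = x) : GlueRel s (x, i) (x, j)

/-- The closed faces of colour `s`. -/
abbrev InternalFace (s : Fin 3) : Type _ :=
  {f : G.Face s // ∀ l : Leg G.kind, Quotient.mk'' l = f → G.line l ≠ l}

variable [Finite V]

/-- The external legs, linked by the external strands of the colours `s i`. -/
def ExternalRel {I : Type*} (s : I → Fin 3) (e e' : G.External) : Prop :=
  ∃ i, G.strandEnd (s i) e = e'

/-- A class that reaches no external leg is one closed face of one colour; any other is determined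
by the linked set of external legs it contains. Two colours are needed for the jackets, all three
for the bound on the faces. -/
theorem classCount_glueRel {I : Type*} [Fintype I] [Nonempty I] (s : I → Fin 3) :
    classCount (G.GlueRel s) =
      ∑ i, Nat.card (G.InternalFace (s i)) + classCount (G.ExternalRel s) := by
  classical
  rw [classCount, classCount, ← Nat.card_sigma, ← Nat.card_sum]
  let r := G.GlueRel s
  -- The chosen end of an open face is immaterial: its two ends are linked by `strandEnd`.
  let h : ∀ i, G.Face (s i) → (Σ i, G.InternalFace (s i)) ⊕ Quot (G.ExternalRel s) := fun i f =>
    if H : ∃ e : G.External, (Quotient.mk'' e.1 : G.Face (s i)) = f then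
      .inr (Quot.mk _ H.choose)
    else .inl ⟨i, f, fun l hl hlf => H ⟨⟨l, hlf⟩, hl⟩⟩
  have hext : ∀ i (e : G.External), h i (Quotient.mk'' e.1) = .inr (Quot.mk _ e) := by
    intro i e
    have H : ∃ e' : G.External, (Quotient.mk'' e'.1 : G.Face (s i)) = Quotient.mk'' e.1 :=
      ⟨e, rfl⟩
    simp only [h, dif_pos H]
    congr 1
    rcases G.external_face_eq H.choose_spec with h' | h'
    · rw [← h']
    · exact Quot.sound ⟨i, h'.symm⟩
  have hint : ∀ i (f : G.InternalFace (s i)), h i f.1 = .inl ⟨i, f⟩ := by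
    intro i f
    have H : ¬ ∃ e : G.External, (Quotient.mk'' e.1 : G.Face (s i)) = f.1 := by
      rintro ⟨e, he⟩
      exact f.2 e.1 he e.2
    simp only [h, dif_neg H]
  let fwd : Quot r → (Σ i, G.InternalFace (s i)) ⊕ Quot (G.ExternalRel s) :=
    Quot.lift (fun d => h d.2 (Quotient.mk'' d.1)) (by
      rintro _ _ (⟨x, i⟩ | ⟨x, i⟩ | ⟨x, i, j, hx⟩)
      · dsimp only; rw [face_mk_line]
      · dsimp only; rw [face_mk_strand]
      · exact (hext i ⟨x, hx⟩).trans (hext j ⟨x, hx⟩).symm)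
  have hmk : ∀ i x y, (Quotient.mk'' x : G.Face (s i)) = Quotient.mk'' y →
      Quot.mk r (x, i) = Quot.mk r (y, i) := fun i x y =>
    G.eq_of_face_eq (fun x => Quot.mk r (x, i)) (fun x => (Quot.sound (.line x i)).symm)
      (fun x => (Quot.sound (.strand x i)).symm)
  refine Nat.card_congr (Equiv.ofBijective fwd ⟨?_, ?_⟩)
  · have hinr : ∀ x i (q : Quot (G.ExternalRel s)), h i (Quotient.mk'' x) = .inr q →
        ∃ e : G.External, Quot.mk _ e = q ∧ Quot.mk r (x, i) = Quot.mk r (e.1, i) := by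
      intro x i q hq
      by_cases H : ∃ e : G.External, (Quotient.mk'' e.1 : G.Face (s i)) = Quotient.mk'' x
      · obtain ⟨e, he⟩ := H
        rw [← he, hext] at hq
        exact ⟨e, Sum.inr_injective hq, (hmk i _ _ he).symm⟩
      · simp only [h, dif_neg H, reduceCtorEq] at hq
    have hglue : ∀ i j (e e' : G.External), Quot.mk (G.ExternalRel s) e = Quot.mk _ e' →
        Quot.mk r (e.1, i) = Quot.mk r (e'.1, j) := by
      intro i j e e' hee
      have : Quot.mk r (e.1, i) = Quot.mk r (e'.1, i) := by
        refine congrArg (Quot.lift (fun e : G.External => Quot.mk r (e.1, i)) ?_) hee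
        rintro a _ ⟨k, rfl⟩
        rw [show Quot.mk r (a.1, i) = Quot.mk r (a.1, k) from Quot.sound (.glue _ _ _ a.2),
          hmk k _ _ (G.strandEnd_face (s k) a).symm]
        exact Quot.sound (.glue _ _ _ (G.strandEnd (s k) a).2)
      exact this.trans (Quot.sound (.glue _ _ _ e'.2))
    rintro ⟨x, i⟩ ⟨y, j⟩ hxy
    change h i (Quotient.mk'' x) = h j (Quotient.mk'' y) at hxy
    rcases hq : h j (Quotient.mk'' y) with ⟨k, f⟩ | q
    · have hface : ∀ i x, h i (Quotient.mk'' x) = .inl ⟨k, f⟩ →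
          ∃ hi : k = i, (Quotient.mk'' x : G.Face (s i)) = hi ▸ f.1 := by
        intro i x hx
        by_cases H : ∃ e : G.External, (Quotient.mk'' e.1 : G.Face (s i)) = Quotient.mk'' x
        · simp only [h, dif_pos H, reduceCtorEq] at hx
        · simp only [h, dif_neg H] at hx
          have hx' := Sum.inl_injective hx
          obtain ⟨rfl, hf⟩ := Sigma.mk.inj_iff.mp hx'
          exact ⟨rfl, congrArg Subtype.val (eq_of_heq hf)⟩
      obtain ⟨rfl, h1⟩ := hface j y hq
      obtain ⟨hi, h2⟩ := hface i x (hxy.trans hq)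
      subst hi
      exact hmk _ _ _ (h2.trans h1.symm)
    · obtain ⟨e, he, hx⟩ := hinr x i q (hxy.trans hq)
      obtain ⟨e', he', hy⟩ := hinr y j q hq
      rw [hx, hy]
      exact hglue _ _ _ _ (he.trans he'.symm)
  · rintro (⟨i, f⟩ | ⟨⟨e⟩⟩)
    · obtain ⟨⟨x⟩, hf⟩ := f
      exact ⟨Quot.mk r (x, i), hint i ⟨_, hf⟩⟩
    · obtain ⟨i⟩ := ‹Nonempty I›
      exact ⟨Quot.mk r (e.1, i), hext i e⟩

end TensorGraph

/-! ### Edges and unpinched faces of coloured graphs. -/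

theorem coloredRibbon_numEdges {X C : Type*} [Finite X] [Fintype C] {pol : X → Bool}
    {line : C → Perm X} {line_line : ∀ c x, line c (line c x) = x} {τ : Perm C} :
    (coloredRibbon pol line line_line τ).numEdges =
      ((∑ c, Nat.card {x // line c x ≠ x} : ℕ) : ℚ) / 2 := by
  rw [RibbonGraph.numEdges, ← Nat.card_sigma]
  congr 2
  exact Nat.card_congr
    { toFun := fun d => ⟨d.1.2, d.1.1, fun h => d.2 (Prod.ext h rfl)⟩
      invFun := fun d => ⟨(d.2.1, d.1), fun h => d.2.2 (congrArg Prod.fst h)⟩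
      left_inv := fun _ => rfl
      right_inv := fun _ => rfl }

theorem classCount_cornerRel {X C : Type*} [Finite X] [Fintype C] {line : C → Perm X} {τ : Perm C}
    (hne : ∀ c x, line c x ≠ x) :
    classCount (CornerRel line τ) =
      ∑ i, classCount fun x y => line i x = y ∨ line (τ i) x = y := by
  rw [classCount_eq_sum_fiber Prod.snd]
  · refine Finset.sum_congr rfl fun i _ => ?_
    refine classCount_congr (fun d => d.1.1) (fun x => ⟨(x, i), rfl⟩) ?_ ?_ ?_ (fun _ => rfl)
    · rintro ⟨⟨x, j⟩, rfl⟩ ⟨⟨y, k⟩, hk⟩ (h | h | ⟨_, _, h⟩)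
      · exact Quot.sound (.inl rfl)
      · exact Quot.sound (.inr rfl)
      · exact absurd h (hne _ _)
    · rintro x _ (rfl | rfl)
      · exact Quot.sound (CornerRel.left x i)
      · exact Quot.sound (CornerRel.right x i)
    · rintro ⟨⟨x, _⟩, rfl⟩
      rfl
  · rintro _ _ (_ | _ | ⟨_, _, h⟩)
    · rfl
    · rfl
    · exact absurd h (hne _ _)

theorem classCount_or_comm {X : Type*} (f g : X → X) :
    (classCount fun x y => f x = y ∨ g x = y) = classCount fun x y => g x = y ∨ f x = y :=
  classCount_congr_rel (fun _ _ h => Quot.sound h.symm) (fun _ _ h => Quot.sound h.symm)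

/-! ### Faces of the pinched jackets. -/

namespace TensorGraph

variable {V : Type*} (G : TensorGraph V)

/-- The number of closed lines formed inside the vertices by the strands of colours `a`, `b`. -/
noncomputable def strandPairCount (a b : Fin 3) : ℕ :=
  classCount fun x y => G.strand a x = y ∨ G.strand b x = y

theorem strandPairCount_comm (a b : Fin 3) : G.strandPairCount a b = G.strandPairCount b a :=
  classCount_or_comm _ _

theorem strand_ne (s : Fin 3) (l : Leg G.kind) : G.strand s l ≠ l := fun h => by
  have : (!l.2.2) = l.2.2 := congrArg (fun l : Leg G.kind => l.2.2) h
  simp at this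

theorem colorLine_polarity (i : Fin 4) (l : Leg G.kind) (h : G.colorLine i l ≠ l) :
    (G.colorLine i l).2.2 = !l.2.2 := by
  induction i using Fin.cases with
  | zero => exact G.line_polarity l h
  | succ s => rfl

theorem pinchedJacket_eq (τ : Perm (Fin 4)) :
    G.pinchedJacket τ =
      coloredRibbon (fun l => l.2.2) G.colorLine G.colorLine_colorLine τ := rfl

variable [Finite V]

/-- The number of closed lines formed by the external strands of colours `a`, `b`. -/
noncomputable def externalPairCount (a b : Fin 3) : ℕ :=
  classCount fun x y => G.strandEnd a x = y ∨ G.strandEnd b x = y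

theorem externalPairCount_comm (a b : Fin 3) :
    G.externalPairCount a b = G.externalPairCount b a :=
  classCount_or_comm _ _

theorem strandEnd_ne (s : Fin 3) (e : G.External) : G.strandEnd s e ≠ e := fun h => by
  have := G.strandEnd_polarity s e
  rw [h] at this
  simp at this

/-- The external strands of colour `s`, as a permutation of the external legs. -/
noncomputable def strandEndPerm (s : Fin 3) : Perm G.External :=
  Function.Involutive.toPerm (G.strandEnd s) (G.strandEnd_strandEnd s)

theorem strandEndPerm_strandEndPerm (s : Fin 3) (e : G.External) :
    G.strandEndPerm s (G.strandEndPerm s e) = e :=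
  G.strandEnd_strandEnd s e

theorem boundary_eq :
    G.boundary = coloredRibbon (fun e : G.External => e.1.2.2) G.strandEndPerm
      G.strandEndPerm_strandEndPerm (finRotate 3) := rfl

/-- The colours `a`, `b`, `c` follow the colour `0` in the cycle `τ`. -/
structure IsCycleOf (τ : Perm (Fin 4)) (a b c : Fin 3) : Prop where
  zero : τ 0 = a.succ
  first : τ a.succ = b.succ
  second : τ b.succ = c.succ
  third : τ c.succ = 0
  ne_ab : a ≠ b
  ne_ac : a ≠ c
  ne_bc : b ≠ c

theorem IsCycleOf.cases {τ : Perm (Fin 4)} {a b c : Fin 3} (h : IsCycleOf τ a b c) (i : Fin 4) :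
    i = 0 ∨ i = a.succ ∨ i = b.succ ∨ i = c.succ := by
  obtain ⟨-, -, -, -, h1, h2, h3⟩ := h
  revert a b c i
  decide

theorem IsCycleOf.transitive {τ : Perm (Fin 4)} {a b c : Fin 3} (h : IsCycleOf τ a b c)
    (T : Set (Fin 4)) (hne : T.Nonempty) (hT : ∀ c, c ∈ T ↔ τ c ∈ T) : T = Set.univ := by
  have h0 := hT 0
  have h1 := hT a.succ
  have h2 := hT b.succ
  rw [h.zero] at h0
  rw [h.first] at h1
  rw [h.second] at h2
  obtain ⟨i, hi⟩ := hne
  refine Set.eq_univ_of_forall fun j => ?_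
  rcases h.cases i with rfl | rfl | rfl | rfl <;> rcases h.cases j with rfl | rfl | rfl | rfl <;>
    tauto

/-- Only lines of colour `0` can be pinched, so pinching exchanges only the two corners next to
colour `0`. These corners follow the strands of colours `a` and `c` through the propagators, which
is the gluing `GlueRel ![a, c]`. -/
theorem jacket_corner_count {τ : Perm (Fin 4)} {a b c : Fin 3} (h : IsCycleOf τ a b c) :
    classCount (CornerRel G.colorLine τ) = G.strandPairCount a b + G.strandPairCount b c +
      (Nat.card (G.InternalFace a) + Nat.card (G.InternalFace c) + G.externalPairCount a c) := by
  have hab : a.succ ≠ b.succ := fun h' => h.ne_ab (Fin.succ_injective _ h')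
  have hac : a.succ ≠ c.succ := fun h' => h.ne_ac (Fin.succ_injective _ h')
  have hbc : b.succ ≠ c.succ := fun h' => h.ne_bc (Fin.succ_injective _ h')
  have hs : ∀ s x, G.colorLine (Fin.succ s) x ≠ x := fun s x => G.strand_ne s x
  let blk : Leg G.kind × Fin 4 → Fin 3 := fun d =>
    if d.2 = a.succ then 0 else if d.2 = b.succ then 1 else 2
  have hpinch : ∀ x i, G.colorLine (τ i) x = x → i = c.succ := by
    intro x i hx
    rcases h.cases i with rfl | rfl | rfl | rfl
    · rw [h.zero] at hx; exact absurd hx (hs _ _)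
    · rw [h.first] at hx; exact absurd hx (hs _ _)
    · rw [h.second] at hx; exact absurd hx (hs _ _)
    · rfl
  rw [classCount_eq_sum_fiber blk, Fin.sum_univ_three]
  · congr 1
    · congr 1
      · have hblk : ∀ x i, blk (x, i) = 0 → i = a.succ := by
          intro x i hi
          by_contra hia
          simp only [blk, hia, if_false] at hi
          split_ifs at hi <;> simp at hi
        refine classCount_congr (fun d => d.1.1) (fun x => ⟨(x, a.succ), by simp [blk]⟩)
          ?_ ?_ ?_ (fun _ => rfl)
        · rintro ⟨⟨x, j⟩, hj⟩ ⟨⟨y, k⟩, hk⟩ (_ | _ | ⟨_, _, hx⟩)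
          · cases hblk _ _ hj
            exact Quot.sound (.inl rfl)
          · cases hblk _ _ hj
            refine Quot.sound (.inr ?_)
            rw [h.first]; rfl
          · rfl
        · rintro x _ (rfl | rfl)
          · exact Quot.sound (CornerRel.left x a.succ)
          · have := CornerRel.right (line := G.colorLine) (τ := τ) x a.succ
            rw [h.first] at this
            exact Quot.sound this
        · rintro ⟨⟨x, i⟩, hi⟩
          cases hblk _ _ hi
          rfl
      · have hblk : ∀ x i, blk (x, i) = 1 → i = b.succ := by
          intro x i hi
          by_contra hia
          simp only [blk, hia, if_false] at hi
          split_ifs at hi <;> simp at hi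
        refine classCount_congr (fun d => d.1.1) (fun x => ⟨(x, b.succ), by simp [blk, hab.symm]⟩)
          ?_ ?_ ?_ (fun _ => rfl)
        · rintro ⟨⟨x, j⟩, hj⟩ ⟨⟨y, k⟩, hk⟩ (_ | _ | ⟨_, _, hx⟩)
          · cases hblk _ _ hj
            exact Quot.sound (.inl rfl)
          · cases hblk _ _ hj
            refine Quot.sound (.inr ?_)
            rw [h.second]; rfl
          · rfl
        · rintro x _ (rfl | rfl)
          · exact Quot.sound (CornerRel.left x b.succ)
          · have := CornerRel.right (line := G.colorLine) (τ := τ) x b.succ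
            rw [h.second] at this
            exact Quot.sound this
        · rintro ⟨⟨x, i⟩, hi⟩
          cases hblk _ _ hi
          rfl
    · have hglue := G.classCount_glueRel ![a, c]
      rw [Fin.sum_univ_two] at hglue
      have hext : classCount (G.ExternalRel ![a, c]) = G.externalPairCount a c := by
        refine classCount_congr_rel ?_ ?_
        · rintro x y ⟨i, hi⟩
          refine Quot.sound ?_
          fin_cases i
          exacts [.inl hi, .inr hi]
        · rintro x y (hi | hi)
          exacts [Quot.sound ⟨0, hi⟩, Quot.sound ⟨1, hi⟩]
      rw [hext] at hglue
      refine Eq.trans ?_ hglue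
      have hblk : ∀ x i, blk (x, i) = 2 → i = 0 ∨ i = c.succ := by
        intro x i hi
        rcases h.cases i with rfl | rfl | rfl | rfl
        · exact .inl rfl
        · simp [blk] at hi
        · simp [blk, hab.symm] at hi
        · exact .inr rfl
      have hc0 : c.succ ≠ 0 := Fin.succ_ne_zero c
      -- Corner `0` lies between colours `0` and `a`, corner `c.succ` between `c` and `0`; they
      -- become the two positions of `![a, c]`.
      refine classCount_congr (fun d => (d.1.1, if d.1.2 = 0 then 0 else 1))
        (fun d => ⟨(d.1, if d.2 = 0 then 0 else c.succ), ?_⟩) ?_ ?_ ?_ ?_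
      · by_cases hd : d.2 = 0
        · simp [blk, hd, (Fin.succ_ne_zero _).symm]
        · simp [blk, hd, hac.symm, hbc.symm]
      · rintro ⟨⟨x, j⟩, hj⟩ ⟨⟨y, k⟩, hk⟩ (_ | _ | ⟨_, _, hx⟩)
        · rcases hblk _ _ hj with rfl | rfl
          · exact Quot.sound (GlueRel.line _ _)
          · simp only [hc0, if_false]
            exact Quot.sound (GlueRel.strand _ _)
        · rcases hblk _ _ hj with rfl | rfl
          · rw! [h.zero]
            exact Quot.sound (GlueRel.strand _ _)
          · rw! [h.third]
            simp only [hc0, if_false]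
            exact Quot.sound (GlueRel.line _ _)
        · cases hpinch _ _ hx
          rw [h.third] at hx
          exact Quot.sound (GlueRel.glue _ _ _ hx)
      · rintro _ _ (⟨x, i⟩ | ⟨x, i⟩ | ⟨x, i, j, hx⟩)
        · fin_cases i
          · exact Quot.sound (CornerRel.left _ _)
          · have := CornerRel.right (line := G.colorLine) (τ := τ) x c.succ
            rw [h.third] at this
            exact Quot.sound this
        · fin_cases i
          · have := CornerRel.right (line := G.colorLine) (τ := τ) x 0
            rw [h.zero] at this
            exact Quot.sound this
          · exact Quot.sound (CornerRel.left _ _)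
        · have := CornerRel.pinch (line := G.colorLine) (τ := τ) x c.succ
            (by rw [h.third]; exact hx)
          rw [h.third] at this
          fin_cases i <;> fin_cases j
          · rfl
          · refine Eq.symm (Quot.sound ?_)
            exact this
          · exact Quot.sound this
          · rfl
      · rintro ⟨⟨x, i⟩, hi⟩
        rcases hblk _ _ hi with rfl | rfl
        · rfl
        · simp [hc0]
      · rintro ⟨x, i⟩
        fin_cases i
        · rfl
        · simp
  · rintro _ _ (_ | _ | ⟨x, i, hx⟩)
    · rfl
    · rfl
    · cases hpinch _ _ hx
      rw [h.third]
      simp [blk, hac.symm, hbc.symm, (Fin.succ_ne_zero _).symm]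

end TensorGraph

/-! ### Counting legs and strands inside the vertices -/

theorem classCount_flip (n : ℕ) :
    (classCount fun x y : Fin n × Bool => (x.1, !x.2) = y) = n := by
  have := Nat.card_congr
    { toFun := Quot.lift (r := fun x y : Fin n × Bool => (x.1, !x.2) = y) Prod.fst
        (by rintro x _ rfl; rfl)
      invFun := fun i => Quot.mk _ (i, true)
      left_inv := by
        rintro ⟨⟨i, b⟩⟩
        cases b
        · exact Quot.sound rfl
        · rfl
      right_inv := fun _ => rfl : _ ≃ Fin n }
  rw [classCount, this, Nat.card_fin]

namespace VertexKind

/-- The number of closed lines formed by the strands of colours `a`, `b` at a vertex. -/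
noncomputable def pairCount (k : VertexKind) (a b : Fin 3) : ℕ :=
  classCount fun x y : Fin k.pairs × Bool =>
    (k.partner a x.1, !x.2) = y ∨ (k.partner b x.1, !x.2) = y

theorem pairCount_comm (k : VertexKind) (a b : Fin 3) : k.pairCount a b = k.pairCount b a :=
  classCount_or_comm (fun x : Fin k.pairs × Bool => (k.partner a x.1, !x.2)) _

theorem pairCount_of_id (k : VertexKind) {a b : Fin 3} (ha : ∀ i, k.partner a i = i)
    (hb : ∀ i, k.partner b i = i) : k.pairCount a b = k.pairs := by
  simp only [pairCount, ha, hb, or_self, classCount_flip]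

theorem pairCount_quartic {a b : Fin 3} (hab : b ≠ a) : (quartic a).pairCount a b = 1 := by
  set r : Fin (quartic a).pairs × Bool → Fin (quartic a).pairs × Bool → Prop := fun x y =>
    ((quartic a).partner a x.1, !x.2) = y ∨ ((quartic a).partner b x.1, !x.2) = y with hr
  have h1 : ∀ (i : Fin 2) (t : Bool), Quot.mk r (i, t) = Quot.mk r (i, !t) := fun i t =>
    Quot.sound (.inr (by simp [partner, hab]))
  have h2 : ∀ (i : Fin 2) (t : Bool), Quot.mk r (i, t) = Quot.mk r (Fin.rev i, !t) := fun i t =>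
    Quot.sound (.inl (by simp [partner]))
  have h3 : ∀ t : Bool, Quot.mk r ((0 : Fin 2), t) = Quot.mk r ((0 : Fin 2), true) := by
    rintro (_ | _)
    · exact h1 0 false
    · rfl
  refine classCount_eq_one ((0 : Fin 2), true) ?_
  rintro ⟨i, t⟩
  change Fin 2 at i
  fin_cases i
  · exact h3 t
  · exact (h2 1 t).trans (h3 _)

/-- At a two-point vertex each colour pair gives one line. At a quartic vertex the two pairs
containing the distinguished colour give one line each, the third pair gives two. -/
theorem pairCount_sum (k : VertexKind) :
    k.pairCount 0 1 + k.pairCount 1 2 + k.pairCount 0 2 = k.pairs + 2 := by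
  cases k with
  | quartic c =>
    fin_cases c
    · rw [Fin.zero_eta, pairCount_quartic (by decide), pairCount_quartic (by decide),
        pairCount_of_id] <;> simp [partner, pairs]
    · rw [Fin.mk_one, pairCount_comm _ 0 1, pairCount_quartic (by decide),
        pairCount_quartic (by decide), pairCount_of_id] <;> simp [partner, pairs]
    · change (quartic 2).pairCount 0 1 + (quartic 2).pairCount 1 2 + (quartic 2).pairCount 0 2 = _
      rw [pairCount_comm _ 1 2, pairCount_comm _ 0 2, pairCount_quartic (by decide),
        pairCount_quartic (by decide), pairCount_of_id] <;> simp [partner, pairs]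
  | mass =>
    have h : ∀ s i, mass.partner s i = i := fun _ _ => rfl
    simp only [mass.pairCount_of_id (h _) (h _), pairs]
  | wave s =>
    have h : ∀ t i, (wave s).partner t i = i := fun _ _ => rfl
    simp only [(wave s).pairCount_of_id (h _) (h _), pairs]

end VertexKind

theorem card_subtype_split {α : Type*} [Finite α] (p q : α → Prop) :
    Nat.card {x // p x ∧ q x} + Nat.card {x // p x ∧ ¬ q x} = Nat.card {x // p x} := by
  classical
  have := Fintype.ofFinite α
  simp only [Nat.card_eq_fintype_card, Fintype.card_subtype]
  rw [← Finset.filter_filter, ← Finset.filter_filter, Finset.card_filter_add_card_filter_not]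

namespace TensorGraph

variable {V : Type*} (G : TensorGraph V)

theorem line_polarity_iff (l : Leg G.kind) (h : G.line l ≠ l) (b : Bool) :
    (G.line l).2.2 = b ↔ l.2.2 = !b := by
  rw [G.line_polarity l h]
  cases l.2.2 <;> cases b <;> simp

theorem line_line_ne (l : Leg G.kind) (h : G.line l ≠ l) : G.line (G.line l) ≠ G.line l := by
  rw [G.line_line]; exact h.symm

theorem card_internal_false :
    Nat.card {l : Leg G.kind // l.2.2 = false ∧ G.line l ≠ l} = G.numLines :=
  Nat.card_congr
    { toFun := fun l => ⟨G.line l.1, (G.line_polarity_iff _ l.2.2 _).mpr l.2.1,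
        G.line_line_ne _ l.2.2⟩
      invFun := fun l => ⟨G.line l.1, (G.line_polarity_iff _ l.2.2 _).mpr l.2.1,
        G.line_line_ne _ l.2.2⟩
      left_inv := fun l => Subtype.ext (G.line_line l.1)
      right_inv := fun l => Subtype.ext (G.line_line l.1) }

section Counting

variable [Fintype V]

theorem strandPairCount_eq_sum (a b : Fin 3) :
    G.strandPairCount a b = ∑ v, (G.kind v).pairCount a b := by
  rw [strandPairCount, classCount_eq_sum_fiber Sigma.fst]
  · refine Finset.sum_congr rfl fun v _ => ?_
    symm
    refine classCount_congr (fun x => ⟨⟨v, x⟩, rfl⟩) (fun l => l.2 ▸ l.1.2) ?_ ?_ (fun _ => rfl) ?_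
    · rintro x _ (rfl | rfl)
      · exact Quot.sound (.inl rfl)
      · exact Quot.sound (.inr rfl)
    · rintro ⟨⟨v, x⟩, rfl⟩ ⟨⟨_, y⟩, hw⟩ (h | h) <;> cases h
      · exact Quot.sound (.inl rfl)
      · exact Quot.sound (.inr rfl)
    · rintro ⟨⟨v, x⟩, rfl⟩
      rfl
  · rintro x _ (rfl | rfl) <;> rfl

theorem strandPairCount_sum :
    G.strandPairCount 0 1 + G.strandPairCount 1 2 + G.strandPairCount 0 2 =
      ∑ v, (G.kind v).pairs + 2 * Fintype.card V := by
  simp only [strandPairCount_eq_sum, ← Finset.sum_add_distrib, VertexKind.pairCount_sum]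
  simp [Finset.sum_add_distrib, mul_comm]

theorem card_polarity (b : Bool) :
    Nat.card {l : Leg G.kind // l.2.2 = b} = ∑ v, (G.kind v).pairs := by
  have : ∀ v, (G.kind v).pairs = Nat.card (Fin (G.kind v).pairs) := fun v => (Nat.card_fin _).symm
  rw [Finset.sum_congr rfl fun v _ => this v, ← Nat.card_sigma]
  exact Nat.card_congr
    { toFun := fun l => ⟨l.1.1, l.1.2.1⟩
      invFun := fun x => ⟨⟨x.1, x.2, b⟩, rfl⟩
      left_inv := by rintro ⟨⟨v, i, _⟩, rfl⟩; rfl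
      right_inv := fun _ => rfl }

theorem card_leg : Nat.card (Leg G.kind) = 2 * ∑ v, (G.kind v).pairs := by
  rw [two_mul, ← G.card_polarity true]
  nth_rewrite 2 [G.card_polarity true]
  rw [← G.card_polarity false]
  have := card_subtype_split (fun _ : Leg G.kind => True) (fun l => l.2.2 = true)
  simp only [true_and, Bool.not_eq_true] at this
  rw [this]
  exact (Nat.card_congr (Equiv.subtypeUnivEquiv fun _ => trivial)).symm

/-- The external legs of each polarity and the propagators exhaust the fields of that polarity. -/
theorem card_external_polarity (b : Bool) :
    G.numLines + Nat.card {e : G.External // e.1.2.2 = b} = ∑ v, (G.kind v).pairs := by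
  have h := card_subtype_split (fun l : Leg G.kind => l.2.2 = b) (fun l => G.line l ≠ l)
  rw [card_polarity] at h
  rw [← h]
  congr 1
  · cases b
    · exact G.card_internal_false.symm
    · rfl
  · exact Nat.card_congr
      { toFun := fun e => ⟨e.1.1, e.2, not_not.mpr e.1.2⟩
        invFun := fun l => ⟨⟨l.1, not_not.mp l.2.2⟩, l.2.1⟩
        left_inv := fun _ => rfl
        right_inv := fun _ => rfl }

theorem numExternal_eq_two_mul (b : Bool) :
    G.numExternal = 2 * Nat.card {e : G.External // e.1.2.2 = b} := by
  have ht := G.card_external_polarity true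
  have hf := G.card_external_polarity false
  have := card_subtype_split (fun _ : G.External => True) (fun e => e.1.2.2 = true)
  simp only [true_and, Bool.not_eq_true] at this
  rw [Nat.card_congr (Equiv.subtypeUnivEquiv fun _ : G.External => trivial)] at this
  rw [numExternal]
  cases b <;> omega

theorem two_mul_numLines_add : 2 * G.numLines + G.numExternal = 2 * ∑ v, (G.kind v).pairs := by
  have := G.card_external_polarity true
  have := G.numExternal_eq_two_mul true
  omega

theorem card_internal : Nat.card {l : Leg G.kind // G.line l ≠ l} = 2 * G.numLines := by
  have := card_subtype_split (fun _ : Leg G.kind => True) (fun l => G.line l ≠ l)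
  simp only [true_and, ne_eq, not_not] at this ⊢
  rw [Nat.card_congr (Equiv.subtypeUnivEquiv fun _ : Leg G.kind => trivial), card_leg] at this
  have h2 := G.two_mul_numLines_add
  change 2 * G.numLines + Nat.card {l // G.line l = l} = _ at h2
  omega

/-- Every vertex contributes two: a quartic one through its two pairs, a two-point one through its
single pair and its own count. -/
theorem sum_pairs : ∑ v, (G.kind v).pairs + G.numMass + ∑ s, G.numWave s = 2 * Fintype.card V := by
  classical
  have hk : ∀ k : VertexKind → Prop,
      Nat.card {v // k (G.kind v)} = ∑ v, if k (G.kind v) then 1 else 0 := by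
    intro k
    rw [Nat.card_eq_fintype_card, Fintype.card_subtype, Finset.card_filter]
  have hm : G.numMass = _ := hk (fun k => k = .mass)
  have hw : ∀ s, G.numWave s = _ := fun s => hk (fun k => k = .wave s)
  rw [hm, Fin.sum_univ_three, hw, hw, hw]
  simp only [← Finset.sum_add_distrib]
  rw [Fintype.card, Finset.card_eq_sum_ones, Finset.mul_sum]
  refine Finset.sum_congr rfl fun v _ => ?_
  cases G.kind v with
  | quartic c => simp [VertexKind.pairs]
  | mass => simp [VertexKind.pairs]
  | wave s => fin_cases s <;> simp [VertexKind.pairs]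

end Counting

/-! ### Connectedness -/

/-- The strands connect all legs of a vertex: a colour that is not distinguished joins the `φ` and
`φ̄` of equal index, and the distinguished colour of a quartic vertex changes the index. -/
theorem eq_of_vertex_eq {β : Sort*} (f : Leg G.kind → β) (hf : ∀ s l, f (G.strand s l) = f l)
    {l l' : Leg G.kind} (h : l.1 = l'.1) : f l = f l' := by
  obtain ⟨v, x⟩ := l
  obtain ⟨w, y⟩ := l'
  obtain rfl : v = w := h
  have hf' : ∀ s (x : Fin (G.kind v).pairs × Bool),
      f ⟨v, (G.kind v).partner s x.1, !x.2⟩ = f ⟨v, x⟩ := fun s x => hf s ⟨v, x⟩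
  clear hf
  generalize hg : (fun x => f ⟨v, x⟩) = g
  have hg' : ∀ x, f ⟨v, x⟩ = g x := fun x => congrFun hg x
  simp only [hg'] at hf' ⊢
  clear hg hg' f
  generalize G.kind v = k at *
  have key : ∀ k : VertexKind, ∀ (g : Fin k.pairs × Bool → β),
      (∀ s x, g (k.partner s x.1, !x.2) = g x) → ∀ i j b b', g (i, b) = g (j, b') := by
    intro k g hg
    have hsub : (∃ s, ∀ i, k.partner s i = i) → ∀ i b b', g (i, b) = g (i, b') := by
      rintro ⟨s, hs⟩ i b b'
      have := hg s (i, b)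
      rw [hs] at this
      by_cases hb : b = b'
      · rw [hb]
      · rw [← this]
        cases b <;> cases b' <;> simp_all
    cases k with
    | quartic c =>
      have h1 := hsub ⟨c + 1, fun i => by simp [VertexKind.partner]⟩
      intro i j b b'
      have h2 := hg c (i, b)
      simp only [VertexKind.partner, if_true] at h2
      by_cases hij : i = j
      · rw [hij]; exact h1 j b b'
      · have : Fin.rev i = j := by
          have H : ∀ i j : Fin 2, i ≠ j → Fin.rev i = j := by decide
          exact H i j hij
        rw [← h2, this]
        exact h1 j _ _
    | mass =>
      intro i j b b'
      rw [Subsingleton.elim (α := Fin 1) i j]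
      exact hsub ⟨0, fun i => rfl⟩ _ _ _
    | wave s =>
      intro i j b b'
      rw [Subsingleton.elim (α := Fin 1) i j]
      exact hsub ⟨0, fun i => rfl⟩ _ _ _
  exact key k g hf' _ _ _ _

theorem exists_leg (v : V) : ∃ l : Leg G.kind, l.1 = v := by
  have : 0 < (G.kind v).pairs := by cases G.kind v <;> simp [VertexKind.pairs]
  exact ⟨⟨v, ⟨0, this⟩, true⟩, rfl⟩

variable {G} in
theorem Connected.eq_of_invariant (hG : G.Connected) {β : Sort*} (f : Leg G.kind → β)
    (hline : ∀ l, f (G.line l) = f l) (hf : ∀ s l, f (G.strand s l) = f l) (l l' : Leg G.kind) :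
    f l = f l' := by
  have hstep : ∀ l l' : Leg G.kind, (SimpleGraph.fromRel fun v w : V =>
      ∃ l : Leg G.kind, l.1 = v ∧ (G.line l).1 = w).Adj l.1 l'.1 → f l = f l' := by
    intro l l' h
    rw [SimpleGraph.fromRel_adj] at h
    rcases h.2 with ⟨m, h1, h2⟩ | ⟨m, h1, h2⟩
    · rw [G.eq_of_vertex_eq f hf h1.symm, ← hline m, G.eq_of_vertex_eq f hf h2]
    · rw [G.eq_of_vertex_eq f hf h1.symm, ← hline m, G.eq_of_vertex_eq f hf h2]
  obtain ⟨p⟩ := hG.preconnected l.1 l'.1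
  suffices H : ∀ v w, (SimpleGraph.fromRel fun v w : V =>
      ∃ l : Leg G.kind, l.1 = v ∧ (G.line l).1 = w).Walk v w →
      ∀ l l' : Leg G.kind, l.1 = v → l'.1 = w → f l = f l' from H _ _ p _ _ rfl rfl
  intro v w p
  induction p with
  | nil => intro l l' h h'; exact G.eq_of_vertex_eq f hf (h.trans h'.symm)
  | @cons u v w hadj p ih =>
    intro l l' h h'
    obtain ⟨m, hm⟩ := G.exists_leg v
    exact (hstep l m (by rw [h, hm]; exact hadj)).trans (ih m l' hm h')

end TensorGraph

namespace TensorGraph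

variable {V : Type*} (G : TensorGraph V)

/-! ### Genus of the pinched jackets -/

theorem pinchedJacket_numComponents (hG : G.Connected) {τ : Perm (Fin 4)} {a b c : Fin 3}
    (h : IsCycleOf τ a b c) : (G.pinchedJacket τ).numComponents = 1 := by
  rw [pinchedJacket_eq, coloredRibbon_numComponents h.transitive]
  obtain ⟨v⟩ := hG.nonempty
  obtain ⟨l, -⟩ := G.exists_leg v
  refine classCount_eq_one l fun l' => ?_
  exact hG.eq_of_invariant _ (fun l => (Quot.sound ⟨0, rfl⟩).symm)
    (fun s l => (Quot.sound ⟨s.succ, rfl⟩).symm) l' l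

theorem numInternalFaces_eq :
    G.numInternalFaces = Nat.card (G.InternalFace 0) + Nat.card (G.InternalFace 1) +
      Nat.card (G.InternalFace 2) := by
  rw [numInternalFaces, Fin.sum_univ_three]

section Jackets

variable [Fintype V]

theorem pinchedJacket_numEdges {τ : Perm (Fin 4)} :
    (G.pinchedJacket τ).numEdges = G.numLines + 3 * (∑ v, (G.kind v).pairs : ℕ) := by
  rw [pinchedJacket_eq, coloredRibbon_numEdges, Fin.sum_univ_succ]
  have h0 : Nat.card {l // G.colorLine 0 l ≠ l} = 2 * G.numLines := G.card_internal
  have hs : ∀ s : Fin 3, Nat.card {l // G.colorLine s.succ l ≠ l} =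
      2 * ∑ v, (G.kind v).pairs := fun s => by
    rw [← card_leg]
    exact Nat.card_congr (Equiv.subtypeUnivEquiv fun l => G.strand_ne s l)
  rw [h0, Finset.sum_congr rfl fun s _ => hs s]
  simp only [Finset.sum_const, Finset.card_univ, Fintype.card_fin, smul_eq_mul]
  push_cast
  ring

theorem two_sub_two_mul_genus (hG : G.Connected) {τ : Perm (Fin 4)} {a b c : Fin 3}
    (h : IsCycleOf τ a b c) :
    2 - 2 * (G.pinchedJacket τ).genus =
      -(∑ v, (G.kind v).pairs : ℕ) - G.numLines + G.strandPairCount a b + G.strandPairCount b c +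
        Nat.card (G.InternalFace a) + Nat.card (G.InternalFace c) + G.externalPairCount a c := by
  rw [RibbonGraph.genus, G.pinchedJacket_numComponents hG h, pinchedJacket_numEdges,
    pinchedJacket_eq, coloredRibbon_numVertices h.transitive,
    coloredRibbon_numFaces G.colorLine_polarity, G.jacket_corner_count h, card_leg]
  push_cast
  ring

theorem isCycleOf_jacketCycle :
    IsCycleOf (jacketCycle 0) 0 1 2 ∧ IsCycleOf (jacketCycle 1) 0 2 1 ∧
      IsCycleOf (jacketCycle 2) 1 0 2 := by
  refine ⟨⟨?_, ?_, ?_, ?_, ?_, ?_, ?_⟩, ⟨?_, ?_, ?_, ?_, ?_, ?_, ?_⟩,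
    ⟨?_, ?_, ?_, ?_, ?_, ?_, ?_⟩⟩ <;> decide

/-- Over the three jackets, each colour is next to `0` twice, each pair of colours surrounds `0`
once, and each pair of colours `1, 2, 3` is adjacent twice. -/
theorem six_sub_two_mul_jacketGenusSum (hG : G.Connected) :
    6 - 2 * G.jacketGenusSum = -(∑ v, (G.kind v).pairs : ℕ) - 3 * G.numLines +
      4 * Fintype.card V + 2 * G.numInternalFaces + (G.externalPairCount 0 1 +
        G.externalPairCount 1 2 + G.externalPairCount 0 2) := by
  obtain ⟨h0, h1, h2⟩ := isCycleOf_jacketCycle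
  have e0 := G.two_sub_two_mul_genus hG h0
  have e1 := G.two_sub_two_mul_genus hG h1
  have e2 := G.two_sub_two_mul_genus hG h2
  have hs := congrArg (Nat.cast (R := ℚ)) G.strandPairCount_sum
  rw [G.strandPairCount_comm 2 1] at e1
  rw [G.strandPairCount_comm 1 0] at e2
  rw [jacketGenusSum, Fin.sum_univ_three, numInternalFaces_eq]
  push_cast at *
  linarith

end Jackets

/-! ### The boundary graph -/

theorem finRotate_transitive (T : Set (Fin 3)) (hne : T.Nonempty)
    (hT : ∀ c, c ∈ T ↔ finRotate 3 c ∈ T) : T = Set.univ := by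
  have h0 : (0 : Fin 3) ∈ T ↔ 1 ∈ T := hT 0
  have h1 : (1 : Fin 3) ∈ T ↔ 2 ∈ T := hT 1
  obtain ⟨i, hi⟩ := hne
  refine Set.eq_univ_of_forall fun j => ?_
  have hcases : ∀ i : Fin 3, i = 0 ∨ i = 1 ∨ i = 2 := by decide
  rcases hcases i with rfl | rfl | rfl <;> rcases hcases j with rfl | rfl | rfl <;> tauto

section Boundary

variable [Finite V]

theorem boundary_numComponents :
    G.boundary.numComponents = classCount (G.ExternalRel id) := by
  rw [boundary_eq, coloredRibbon_numComponents finRotate_transitive]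
  rfl

/-- The boundary graph is trivalent, without pinched lines, and its faces are the bicoloured
external lines already met in the jackets. -/
theorem two_mul_boundary_genus :
    2 * G.boundary.genus = 2 * G.boundary.numComponents + G.numExternal / 2 -
      (G.externalPairCount 0 1 + G.externalPairCount 1 2 + G.externalPairCount 0 2) := by
  have hV : G.boundary.numVertices = G.numExternal :=
    coloredRibbon_numVertices (line_line := G.strandEndPerm_strandEndPerm) finRotate_transitive
  have hE : G.boundary.numEdges = (3 * G.numExternal : ℚ) / 2 := by
    rw [boundary_eq, coloredRibbon_numEdges]
    have : ∀ s, Nat.card {e // G.strandEndPerm s e ≠ e} = G.numExternal := fun s =>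
      Nat.card_congr (Equiv.subtypeUnivEquiv fun e => G.strandEnd_ne s e)
    rw [Finset.sum_congr rfl fun s _ => this s]
    simp
  have hF : G.boundary.numFaces =
      G.externalPairCount 0 1 + G.externalPairCount 1 2 + G.externalPairCount 0 2 := by
    rw [boundary_eq, coloredRibbon_numFaces fun s e _ => G.strandEnd_polarity s e,
      classCount_cornerRel (line := G.strandEndPerm) fun s e => G.strandEnd_ne s e, Fin.sum_univ_three, G.externalPairCount_comm 0 2]
    rfl
  rw [RibbonGraph.genus, hV, hE, hF]
  push_cast
  ring

end Boundary

/-! ### The divergence degree in terms of the genera -/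

theorem divergenceDegree_eq [Finite V] (hG : G.Connected) :
    (G.divergenceDegree : ℚ) = 3 - G.jacketGenusSum - G.numExternal / 2 - G.numMass -
      G.boundary.numComponents + G.boundary.genus := by
  have := Fintype.ofFinite V
  have h1 := G.six_sub_two_mul_jacketGenusSum hG
  have h2 := G.two_mul_boundary_genus
  have h3 := congrArg (Nat.cast (R := ℚ)) G.sum_pairs
  have h4 := congrArg (Nat.cast (R := ℚ)) G.two_mul_numLines_add
  rw [divergenceDegree]
  push_cast at *
  linarith

end TensorGraph

namespace TensorGraph

variable {V : Type*} (G : TensorGraph V)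

/-! ### A bound on the number of closed faces -/

/-- The sign of the polarity of a leg. -/
def sign {kind : V → VertexKind} (l : Leg kind) : ℚ := if l.2.2 then 1 else -1

theorem sign_eq_neg {kind : V → VertexKind} {l l' : Leg kind} (h : l'.2.2 = !l.2.2) :
    sign l' = -sign l := by
  rw [sign, sign, h]
  cases l.2.2 <;> simp

/-- Conservation law: a strand joins a `φ` to a `φ̄`, so its two ends cancel. -/
theorem sum_sign_mul_of_strand {s : Fin 3} {k : Leg G.kind → ℚ} (hk : ∀ l, k (G.strand s l) = k l)
    (A : Finset (Leg G.kind)) (hA : ∀ l ∈ A, G.strand s l ∈ A) : ∑ l ∈ A, sign l * k l = 0 :=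
  Finset.sum_involution (fun l _ => G.strand s l)
    (fun l _ => by rw [sign_eq_neg (l := l) (l' := G.strand s l) rfl, hk]; ring)
    (fun l _ _ => G.strand_ne s l) hA (fun l _ => G.strand_strand s l)

/-- If the only propagator that carries a nonzero value of `d` out of `A` starts at `x`, then
`d` vanishes at `x` as soon as the signed sum of `d` over `A` vanishes. -/
theorem eq_zero_of_cut {d : Leg G.kind → ℚ} (hline : ∀ l, d (G.line l) = d l)
    (hext : ∀ l, G.line l = l → d l = 0) {A : Finset (Leg G.kind)}
    (hsum : ∑ l ∈ A, sign l * d l = 0) {x : Leg G.kind} (hx : x ∈ A)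
    (hcut : ∀ z ∈ A, z ≠ x → d z ≠ 0 → G.line z ∈ A ∧ G.line z ≠ x) : d x = 0 := by
  classical
  -- Apart from `x`, the legs of `A` with nonzero `d` are paired by propagators within `A`, with
  -- opposite signs.
  have hrest : ∑ l ∈ (A.erase x).filter (fun l => d l ≠ 0), sign l * d l = 0 := by
    have hmem : ∀ l ∈ (A.erase x).filter (fun l => d l ≠ 0),
        G.line l ∈ (A.erase x).filter (fun l => d l ≠ 0) := by
      intro l hl
      simp only [Finset.mem_filter, Finset.mem_erase] at hl ⊢
      obtain ⟨h1, h2⟩ := hcut l hl.1.2 hl.1.1 hl.2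
      exact ⟨⟨h2, h1⟩, by rw [hline]; exact hl.2⟩
    have hne : ∀ l ∈ (A.erase x).filter (fun l => d l ≠ 0), G.line l ≠ l := fun l hl h =>
      (Finset.mem_filter.mp hl).2 (hext l h)
    exact Finset.sum_involution (fun l _ => G.line l)
      (fun l hl => by rw [sign_eq_neg (G.line_polarity l (hne l hl)), hline]; ring)
      (fun l hl _ => hne l hl) hmem (fun l _ => G.line_line l)
  rw [Finset.sum_filter_of_ne fun l _ h => right_ne_zero_of_mul h] at hrest
  rw [← Finset.add_sum_erase A _ hx, hrest, add_zero] at hsum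
  refine (mul_eq_zero.mp hsum).resolve_left ?_
  rw [sign]
  split_ifs <;> norm_num

/-- The propagators, each given by its end `φ`. -/
abbrev Propagator : Type _ := {l : Leg G.kind // l.2.2 = true ∧ G.line l ≠ l}

theorem exists_propagator {v w : V} (h : (SimpleGraph.fromRel fun v w : V =>
      ∃ l : Leg G.kind, l.1 = v ∧ (G.line l).1 = w).Adj v w) :
    ∃ p : G.Propagator, s(p.1.1, (G.line p.1).1) = s(v, w) := by
  rw [SimpleGraph.fromRel_adj] at h
  obtain ⟨hne, h⟩ := h
  have key : ∀ l : Leg G.kind, l.1 ≠ (G.line l).1 →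
      ∃ p : G.Propagator, s(p.1.1, (G.line p.1).1) = s(l.1, (G.line l).1) := by
    intro l hl
    have hll : G.line l ≠ l := fun h => hl (congrArg Sigma.fst h.symm)
    cases hb : l.2.2 with
    | true => exact ⟨⟨l, hb, hll⟩, rfl⟩
    | false =>
      refine ⟨⟨G.line l, (G.line_polarity_iff l hll _).mpr hb, G.line_line_ne l hll⟩, ?_⟩
      exact (congrArg (fun m : Leg G.kind => s((G.line l).1, m.1)) (G.line_line l)).trans
        Sym2.eq_swap
  rcases h with ⟨l, rfl, rfl⟩ | ⟨l, rfl, rfl⟩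
  · exact key l hne
  · rw [Sym2.eq_swap]
    exact key l hne.symm

/-- A function on the glued strand lines that does not depend on the colour at the propagators
outside a spanning tree does not depend on the colour at all. -/
theorem colour_independent [Finite V] {T : SimpleGraph V} (hT : T.IsTree)
    (t : T.edgeSet → G.Propagator) (ht : ∀ e, s((t e).1.1, (G.line (t e).1).1) = e.1)
    (k : Quot (G.GlueRel id) → ℚ) (s : Fin 3)
    (hk : ∀ p : G.Propagator, p ∉ Set.range t → k (Quot.mk _ (p.1, s)) = k (Quot.mk _ (p.1, 0)))
    (l : Leg G.kind) (hl : G.line l = l ∨ l.2.2 = true) :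
    k (Quot.mk _ (l, s)) = k (Quot.mk _ (l, 0)) := by
  classical
  have := Fintype.ofFinite (Leg G.kind)
  -- This is the conserved current. It vanishes at the external legs, where the colours are glued,
  -- and by `hk` on the propagators outside the tree.
  set d : Leg G.kind → ℚ := fun l => k (Quot.mk _ (l, s)) - k (Quot.mk _ (l, 0)) with hd
  have hline : ∀ l, d (G.line l) = d l := fun l => by
    simp only [hd]
    rw [← Quot.sound (GlueRel.line l s), ← Quot.sound (GlueRel.line l 0)]
  have hext : ∀ l, G.line l = l → d l = 0 := fun l h => by
    simp only [hd]
    rw [Quot.sound (GlueRel.glue l s 0 h), sub_self]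
  suffices hprop : ∀ p : G.Propagator, d p.1 = 0 by
    by_cases h : G.line l = l
    · exact sub_eq_zero.mp (hext l h)
    · exact sub_eq_zero.mp (hprop ⟨l, hl.resolve_left h, h⟩)
  intro p
  by_cases hp : p ∈ Set.range t
  swap
  · exact sub_eq_zero.mpr (hk p hp)
  obtain ⟨e, rfl⟩ := hp
  have hbridge : ¬(T.deleteEdges {e.1}).Reachable (t e).1.1 (G.line (t e).1).1 := by
    have := SimpleGraph.isAcyclic_iff_forall_isBridge.mp hT.isAcyclic e.2
    rw [← ht e, SimpleGraph.isBridge_iff] at this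
    rwa [← ht e]
  -- The side of the `φ` end of the tree edge `e` once `e` is removed. Propagators outside the tree
  -- may cross this cut, but carry no current.
  set A : Finset (Leg G.kind) :=
    Finset.univ.filter fun l => (T.deleteEdges {e.1}).Reachable (t e).1.1 l.1 with hAdef
  have hA : ∀ l, l ∈ A ↔ (T.deleteEdges {e.1}).Reachable (t e).1.1 l.1 := by simp [hAdef]
  have hsum : ∑ l ∈ A, sign l * d l = 0 := by
    simp only [hd, mul_sub, Finset.sum_sub_distrib]
    have hs : ∀ s : Fin 3, ∑ l ∈ A, sign l * k (Quot.mk _ (l, s)) = 0 := fun s =>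
      G.sum_sign_mul_of_strand (s := s)
        (fun l => by rw [Quot.sound (GlueRel.strand (s := id) l s)]; rfl) A
        (fun l hl => (hA _).mpr ((hA l).mp hl))
    rw [hs, hs, sub_zero]
  refine G.eq_zero_of_cut hline hext hsum ((hA _).mpr (SimpleGraph.Reachable.refl _)) ?_
  have hprop : ∀ p : G.Propagator, d p.1 ≠ 0 → p ≠ t e →
      ((T.deleteEdges {e.1}).Adj p.1.1 (G.line p.1).1) := by
    intro p hdp hpe
    by_cases hp : p ∈ Set.range t
    · obtain ⟨e', rfl⟩ := hp
      have hee : e' ≠ e := fun h => hpe (h ▸ rfl)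
      rw [SimpleGraph.deleteEdges_adj, ← SimpleGraph.mem_edgeSet, ht e']
      exact ⟨e'.2, fun h => hee (Subtype.ext h)⟩
    · exact absurd (sub_eq_zero.mpr (hk p hp)) hdp
  intro z hz hzx hdz
  have hzz : G.line z ≠ z := fun h => hdz (hext z h)
  rw [hA] at hz
  have hlx : G.line z ≠ (t e).1 := by
    intro h
    apply hbridge
    rw [← h, G.line_line, h]
    exact hz
  refine ⟨(hA _).mpr ?_, hlx⟩
  cases hb : z.2.2 with
  | true =>
    exact hz.trans (hprop ⟨z, hb, hzz⟩ hdz fun h => hzx (congrArg Subtype.val h)).reachable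
  | false =>
    have := hprop ⟨G.line z, (G.line_polarity_iff z hzz _).mpr hb, G.line_line_ne z hzz⟩
      (by rw [hline]; exact hdz) (fun h => hlx (congrArg Subtype.val h))
    dsimp only at this
    rw [G.line_line] at this
    exact hz.trans this.symm.reachable

/-- The number of glued strand lines is at most one plus twice the number of loops of `G`. -/
theorem classCount_glueRel_le [Fintype V] (hG : G.Connected) :
    classCount (G.GlueRel id) + 2 * Fintype.card V ≤ 3 + 2 * G.numLines := by
  classical
  obtain ⟨T, hTG, hT⟩ := SimpleGraph.Connected.exists_isTree_le hG
  have hex : ∀ e : T.edgeSet, ∃ p : G.Propagator, s(p.1.1, (G.line p.1).1) = e.1 := by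
    rintro ⟨⟨v, w⟩, he⟩
    exact G.exists_propagator (hTG he)
  choose t ht using hex
  have hinj : Function.Injective t := fun e e' h => Subtype.ext (by rw [← ht e, ← ht e', h])
  have := Fintype.ofFinite G.Propagator
  have := Fintype.ofFinite (Quot (G.GlueRel id))
  let N := {p : G.Propagator // p ∉ Set.range t}
  have hcard : Fintype.card N + Fintype.card V = G.numLines + 1 := by
    have h1 : Fintype.card {p : G.Propagator // p ∈ Set.range t} + 1 = Fintype.card V := by
      rw [← hT.card_edgeFinset, SimpleGraph.edgeFinset_card]
      congr 1
      exact (Fintype.card_congr (Equiv.ofInjective t hinj)).symm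
    have h2 := Fintype.card_subtype_compl (fun p : G.Propagator => p ∈ Set.range t)
    have h3 := Fintype.card_subtype_le (fun p : G.Propagator => p ∈ Set.range t)
    have h4 : G.numLines = Fintype.card G.Propagator := Nat.card_eq_fintype_card
    change Fintype.card N = _ at h2
    omega
  -- For each propagator outside the tree, two conditions compare the two other colours with the
  -- first. The kernel consists of constants, so the number of classes is at most one plus the
  -- number of conditions.
  let Φ : (Quot (G.GlueRel id) → ℚ) →ₗ[ℚ] (N × Fin 2 → ℚ) :=
    { toFun := fun k x => k (Quot.mk _ (x.1.1.1, x.2.succ)) - k (Quot.mk _ (x.1.1.1, 0))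
      map_add' := fun k k' => by ext x; simp only [Pi.add_apply]; ring
      map_smul' := fun c k => by
        ext x; simp only [Pi.smul_apply, smul_eq_mul, RingHom.id_apply]; ring }
  have hker : LinearMap.ker Φ ≤ Submodule.span ℚ {fun _ => 1} := by
    intro k hk
    have hk0 : ∀ (s : Fin 3) (p : G.Propagator), p ∉ Set.range t →
        k (Quot.mk _ (p.1, s)) = k (Quot.mk _ (p.1, 0)) := by
      intro s p hp
      induction s using Fin.cases with
      | zero => rfl
      | succ s => exact sub_eq_zero.mp (congrFun (LinearMap.mem_ker.mp hk) (⟨p, hp⟩, s))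
    have hcol : ∀ (l : Leg G.kind) (s : Fin 3),
        k (Quot.mk _ (l, s)) = k (Quot.mk _ (l, 0)) := by
      intro l s
      by_cases hl : G.line l = l ∨ l.2.2 = true
      · exact G.colour_independent hT t ht k s (hk0 s) l hl
      · push Not at hl
        have hb : l.2.2 = false := by simpa using hl.2
        rw [Quot.sound (GlueRel.line l s), Quot.sound (GlueRel.line (s := id) l (0 : Fin 3))]
        exact G.colour_independent hT t ht k s (hk0 s) _
          (.inr ((G.line_polarity_iff l hl.1 _).mpr hb))
    -- Once `k` ignores the colour, it is invariant under the strands of every colour, and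
    -- connectedness applies.
    have hconst : ∀ l l' : Leg G.kind, k (Quot.mk _ (l, 0)) = k (Quot.mk _ (l', 0)) :=
      hG.eq_of_invariant _ (fun l => by rw [← Quot.sound (GlueRel.line (s := id) l (0 : Fin 3))])
        (fun s l => by
          rw [← hcol _ s, ← hcol l s, Quot.sound (GlueRel.strand (s := id) l s)]
          rfl)
    obtain ⟨v⟩ := hG.nonempty
    obtain ⟨l₀, -⟩ := G.exists_leg v
    refine Submodule.mem_span_singleton.mpr ⟨k (Quot.mk _ (l₀, 0)), ?_⟩
    ext ⟨⟨l, s⟩⟩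
    simp only [Pi.smul_apply, smul_eq_mul, mul_one]
    rw [hcol l s, hconst]
  have hk1 : Module.finrank ℚ (LinearMap.ker Φ) ≤ 1 :=
    (Submodule.finrank_mono hker).trans (by
      simpa using finrank_span_le_card (R := ℚ) {(fun _ => 1 : Quot (G.GlueRel id) → ℚ)})
  have hr : Module.finrank ℚ (LinearMap.range Φ) ≤ Fintype.card N * 2 := by
    refine (Submodule.finrank_le _).trans ?_
    rw [Module.finrank_fintype_fun_eq_card, Fintype.card_prod, Fintype.card_fin]
  have htot := LinearMap.finrank_range_add_finrank_ker Φ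
  rw [Module.finrank_fintype_fun_eq_card] at htot
  rw [classCount, Nat.card_eq_fintype_card]
  omega

/-- Compared with `divergenceDegree_eq`, this amounts to `g_∂ ≤ ∑ g_J̃`, obtained here by counting
faces rather than by comparing surfaces. -/
theorem divergenceDegree_le [Finite V] (hG : G.Connected) :
    2 * G.divergenceDegree ≤
      6 - (G.numExternal : ℤ) - 2 * G.boundary.numComponents - 2 * G.numMass := by
  have := Fintype.ofFinite V
  have h1 := G.classCount_glueRel_le hG
  rw [classCount_glueRel, ← boundary_numComponents] at h1
  change G.numInternalFaces + _ + _ ≤ _ at h1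
  have h3 := G.sum_pairs
  have h4 := G.two_mul_numLines_add
  rw [divergenceDegree, ← Nat.cast_sum]
  omega

/-! ### Boundary graphs with few vertices -/

section SmallBoundary

variable [Finite V]

/-- An involution that exchanges the polarities has one orbit for each point of positive
polarity. -/
theorem classCount_involution {X : Type*} {pol : X → Bool} {f : X → X} (hf : ∀ x, f (f x) = x)
    (hpol : ∀ x, pol (f x) = !pol x) :
    (classCount fun x y => f x = y) = Nat.card {x // pol x = true} := by
  classical
  let g : X → {x // pol x = true} := fun x =>
    if h : pol x = true then ⟨x, h⟩ else ⟨f x, by rw [hpol]; simpa using h⟩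
  refine Nat.card_congr
    { toFun := Quot.lift g ?_
      invFun := fun x => Quot.mk _ x.1
      left_inv := ?_
      right_inv := fun x => dif_pos x.2 }
  · rintro x _ rfl
    by_cases h : pol x = true
    · simp [g, h, hpol, hf]
    · simp [g, h, hpol]
  · rintro ⟨x⟩
    by_cases h : pol x = true
    · simp [g, h]
    · have hg : (g x).1 = f x := by simp [g, h]
      refine (Eq.symm (Quot.sound ?_))
      exact hg.symm

theorem classCount_strandEnd (s : Fin 3) :
    2 * (classCount fun x y => G.strandEnd s x = y) = G.numExternal := by
  have := Fintype.ofFinite V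
  rw [classCount_involution (pol := fun e : G.External => e.1.2.2) (G.strandEnd_strandEnd s)
    (G.strandEnd_polarity s), ← G.numExternal_eq_two_mul]

theorem externalPairCount_of_eq {a b : Fin 3} (h : G.strandEnd a = G.strandEnd b) :
    2 * G.externalPairCount a b = G.numExternal := by
  rw [← G.classCount_strandEnd a, externalPairCount, h]
  simp only [or_self]

theorem boundary_numComponents_of_all_eq (h : ∀ s, G.strandEnd s = G.strandEnd 0) :
    2 * G.boundary.numComponents = G.numExternal := by
  rw [boundary_numComponents, ← G.classCount_strandEnd 0]
  congr 1
  refine classCount_congr_rel ?_ ?_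
  · rintro x _ ⟨s, rfl⟩
    rw [h (id s)]
    exact Quot.sound (r := fun x y => G.strandEnd 0 x = y) rfl
  · rintro x _ rfl
    exact Quot.sound ⟨0, rfl⟩

/-- Each component consists of two legs joined by three parallel lines, which is a sphere. -/
theorem boundary_genus_of_all_eq (h : ∀ s, G.strandEnd s = G.strandEnd 0) :
    G.boundary.genus = 0 := by
  have h01 := congrArg (Nat.cast (R := ℚ)) (G.externalPairCount_of_eq ((h 0).trans (h 1).symm))
  have h12 := congrArg (Nat.cast (R := ℚ)) (G.externalPairCount_of_eq ((h 1).trans (h 2).symm))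
  have h02 := congrArg (Nat.cast (R := ℚ)) (G.externalPairCount_of_eq ((h 0).trans (h 2).symm))
  have hC := congrArg (Nat.cast (R := ℚ)) (G.boundary_numComponents_of_all_eq h)
  have := G.two_mul_boundary_genus
  push_cast at *
  linarith

theorem card_external_polarity_of_eq {n : ℕ} (hN : G.numExternal = 2 * n) (b : Bool) :
    Nat.card {e : G.External // e.1.2.2 = b} = n := by
  have := Fintype.ofFinite V
  have := G.numExternal_eq_two_mul b
  omega

theorem strandEnd_eq_of_two (hN : G.numExternal = 2) (a b : Fin 3) :
    G.strandEnd a = G.strandEnd b := by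
  funext e
  have h := (Nat.card_eq_one_iff_unique.mp
    (G.card_external_polarity_of_eq (n := 1) hN (!e.1.2.2))).1
  exact congrArg Subtype.val (h.elim ⟨_, G.strandEnd_polarity a e⟩ ⟨_, G.strandEnd_polarity b e⟩)

theorem eq_or_eq_of_polarity (hN : G.numExternal = 4) {p q z : G.External} (hpq : p ≠ q)
    (hp : p.1.2.2 = z.1.2.2) (hq : q.1.2.2 = z.1.2.2) : z = p ∨ z = q := by
  have h := (Nat.card_eq_two_iff' (⟨p, hp⟩ : {e : G.External // e.1.2.2 = z.1.2.2})).mp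
    (G.card_external_polarity_of_eq (n := 2) hN _)
  by_cases hz : z = p
  · exact .inl hz
  · have := h.unique (y₁ := ⟨z, rfl⟩) (y₂ := ⟨q, hq⟩) (fun h => hz (congrArg Subtype.val h))
      (fun h => hpq (congrArg Subtype.val h).symm)
    exact .inr (congrArg Subtype.val this)

/-- With four external legs, two different sets of external strands link all the legs. -/
theorem eq_of_strandEnd_ne (hN : G.numExternal = 4) {a b : Fin 3}
    (h : G.strandEnd a ≠ G.strandEnd b) {β : Sort*} (f : G.External → β)
    (ha : ∀ e, f (G.strandEnd a e) = f e) (hb : ∀ e, f (G.strandEnd b e) = f e)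
    (e e' : G.External) : f e = f e' := by
  obtain ⟨x, hx⟩ := Function.ne_iff.mp h
  have hopp : ∀ z : G.External, z.1.2.2 = (!x.1.2.2) → f z = f x := by
    intro z hz
    rcases G.eq_or_eq_of_polarity hN hx ((G.strandEnd_polarity a x).trans hz.symm)
      ((G.strandEnd_polarity b x).trans hz.symm) with rfl | rfl
    exacts [ha x, hb x]
  have hall : ∀ z, f z = f x := by
    intro z
    by_cases hz : z.1.2.2 = !x.1.2.2
    · exact hopp z hz
    · rw [← ha z]
      refine hopp _ ?_
      rw [G.strandEnd_polarity]
      simpa using hz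
  rw [hall e, hall e']

theorem strandEnd_apply_ne (hN : G.numExternal = 4) {a b : Fin 3}
    (h : G.strandEnd a ≠ G.strandEnd b) (e : G.External) : G.strandEnd a e ≠ G.strandEnd b e := by
  obtain ⟨x, hx⟩ := Function.ne_iff.mp h
  have hsame : ∀ z : G.External, z.1.2.2 = x.1.2.2 → G.strandEnd a z ≠ G.strandEnd b z := by
    intro z hz hzz
    have hpol : ∀ s t, (G.strandEnd s x).1.2.2 = (G.strandEnd t z).1.2.2 := fun s t => by
      rw [G.strandEnd_polarity, G.strandEnd_polarity, hz]
    have hzx : z = x := by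
      rcases G.eq_or_eq_of_polarity hN hx (hpol a a) (hpol b a) with h' | h'
      · exact (G.strandEndPerm a).injective h'
      · rw [hzz] at h'
        exact (G.strandEndPerm b).injective h'
    exact hx (hzx ▸ hzz)
  by_cases he : e.1.2.2 = x.1.2.2
  · exact hsame e he
  · intro heq
    refine hsame (G.strandEnd a e) ?_ ?_
    · rw [G.strandEnd_polarity, Bool.not_eq_eq_eq_not]
      simpa [Bool.eq_not] using he
    · rw [G.strandEnd_strandEnd, heq, G.strandEnd_strandEnd]

theorem strandEnd_eq_of_ne (hN : G.numExternal = 4) {a b c : Fin 3}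
    (hab : G.strandEnd a ≠ G.strandEnd b) (hac : G.strandEnd a ≠ G.strandEnd c) :
    G.strandEnd b = G.strandEnd c := by
  funext e
  have hpol : ∀ s t, (G.strandEnd s e).1.2.2 = (G.strandEnd t e).1.2.2 := fun s t => by
    rw [G.strandEnd_polarity, G.strandEnd_polarity]
  rcases G.eq_or_eq_of_polarity hN (G.strandEnd_apply_ne hN hab e) (hpol a c) (hpol b c) with h | h
  · exact absurd h.symm (G.strandEnd_apply_ne hN hac e)
  · exact h.symm

theorem externalPairCount_of_ne (hN : G.numExternal = 4) {a b : Fin 3}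
    (h : G.strandEnd a ≠ G.strandEnd b) : G.externalPairCount a b = 1 := by
  obtain ⟨e, -⟩ := Function.ne_iff.mp h
  exact classCount_eq_one e fun e' => G.eq_of_strandEnd_ne hN h _
    (fun _ => (Quot.sound (.inl rfl)).symm) (fun _ => (Quot.sound (.inr rfl)).symm) e' e

theorem boundary_numComponents_of_ne (hN : G.numExternal = 4) {a b : Fin 3}
    (h : G.strandEnd a ≠ G.strandEnd b) : G.boundary.numComponents = 1 := by
  obtain ⟨e, -⟩ := Function.ne_iff.mp h
  rw [boundary_numComponents]
  exact classCount_eq_one e fun e' => G.eq_of_strandEnd_ne hN h _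
    (fun _ => (Quot.sound ⟨a, rfl⟩).symm) (fun _ => (Quot.sound ⟨b, rfl⟩).symm) e' e

/-- Two of the three matchings coincide. Either all three do, or exactly one differs; in the latter
case there is one component, with `2 + 1 + 1` faces, hence a sphere. -/
theorem boundary_genus_of_four (hN : G.numExternal = 4) : G.boundary.genus = 0 := by
  have hg := G.two_mul_boundary_genus
  have heq : ∀ {a b}, G.strandEnd a = G.strandEnd b → G.externalPairCount a b = 2 := fun h => by
    have := G.externalPairCount_of_eq h
    omega
  have hne : ∀ {a b}, G.strandEnd a ≠ G.strandEnd b → G.externalPairCount a b = 1 := fun h =>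
    G.externalPairCount_of_ne hN h
  by_cases h01 : G.strandEnd 0 = G.strandEnd 1
  · by_cases h02 : G.strandEnd 0 = G.strandEnd 2
    · refine G.boundary_genus_of_all_eq fun s => ?_
      fin_cases s
      exacts [rfl, h01.symm, h02.symm]
    · rw [heq h01, hne h02, hne (h01 ▸ h02), hN, G.boundary_numComponents_of_ne hN h02] at hg
      norm_num at hg
      exact hg
  · by_cases h02 : G.strandEnd 0 = G.strandEnd 2
    · rw [hne h01, heq h02, hne fun h => h01 (h02.trans h.symm), hN,
        G.boundary_numComponents_of_ne hN h01] at hg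
      norm_num at hg
      exact hg
    · rw [hne h01, hne h02, heq (G.strandEnd_eq_of_ne hN h01 h02), hN,
        G.boundary_numComponents_of_ne hN h01] at hg
      norm_num at hg
      exact hg

end SmallBoundary

end TensorGraph

/-! ### Classification of the divergent graphs. -/

theorem mainTheorem4 {V : Type*} [Finite V] (G : TensorGraph V) (hconn : G.Connected)
    (hext : 0 < G.numExternal) :
    (0 ≤ G.divergenceDegree ↔
      G.HasData 4 0 0 0 0 ∨ G.HasData 2 0 0 0 0 ∨ G.HasData 2 1 0 0 0 ∨ G.HasData 2 0 0 0 1) ∧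
    (G.HasData 4 0 0 0 0 → G.divergenceDegree = 0) ∧
    (G.HasData 2 0 0 0 0 → G.divergenceDegree = 1) ∧
    (G.HasData 2 1 0 0 0 → G.divergenceDegree = 0) ∧
    (G.HasData 2 0 0 0 1 → G.divergenceDegree = 0) ∧
    (6 ≤ G.numExternal → G.divergenceDegree < 0) := by
  have hformula := G.divergenceDegree_eq hconn
  have hle := G.divergenceDegree_le hconn
  have hC : 1 ≤ G.boundary.numComponents := by
    obtain ⟨⟨e⟩, -⟩ := Nat.card_pos_iff.mp hext
    rw [G.boundary_numComponents]
    exact classCount_pos _ e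
  have heven : ∃ n, G.numExternal = 2 * n := by
    have := Fintype.ofFinite V
    exact ⟨_, G.numExternal_eq_two_mul true⟩
  have hvalue : ∀ {n v : ℕ} {gj : ℚ} (d : ℤ), G.HasData n v 0 0 gj →
      (d : ℚ) = 2 - gj - n / 2 - v → G.divergenceDegree = d := by
    rintro n v gj d ⟨h1, h2, h3, h4, h5⟩ hd
    rw [h1, h2, h3, h5] at hformula
    have : (G.divergenceDegree : ℚ) = d := by linarith
    exact_mod_cast this
  have v4 : G.HasData 4 0 0 0 0 → G.divergenceDegree = 0 := fun h => hvalue 0 h (by norm_num)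
  have v2 : G.HasData 2 0 0 0 0 → G.divergenceDegree = 1 := fun h => hvalue 1 h (by norm_num)
  have v2m : G.HasData 2 1 0 0 0 → G.divergenceDegree = 0 := fun h => hvalue 0 h (by norm_num)
  have v2g : G.HasData 2 0 0 0 1 → G.divergenceDegree = 0 := fun h => hvalue 0 h (by norm_num)
  refine ⟨⟨fun hω => ?_, ?_⟩, v4, v2, v2m, v2g, fun h6 => by omega⟩
  · obtain ⟨n, hn⟩ := heven
    -- With `C_∂ ≥ 1` the bound reads `ω ≤ 2 - n - V_2`.
    have hn12 : n = 1 ∨ n = 2 := by omega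
    rcases hn12 with rfl | rfl
    · have hall := fun s => G.strandEnd_eq_of_two hn s 0
      have hg := G.boundary_genus_of_all_eq hall
      have hC2 := G.boundary_numComponents_of_all_eq hall
      have hC1 : G.boundary.numComponents = 1 := by omega
      have hcases : G.divergenceDegree = 1 ∧ G.numMass = 0 ∨
          G.divergenceDegree = 0 ∧ G.numMass = 1 ∨ G.divergenceDegree = 0 ∧ G.numMass = 0 := by
        omega
      rw [hg, hC1, hn] at hformula
      right
      rcases hcases with ⟨hd, hm⟩ | ⟨hd, hm⟩ | ⟨hd, hm⟩ <;> rw [hd, hm] at hformula <;>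
        norm_num at hformula
      · exact .inl ⟨hn, hm, hg, by rw [hC1]; norm_num, by linarith⟩
      · exact .inr (.inl ⟨hn, hm, hg, by rw [hC1]; norm_num, by linarith⟩)
      · exact .inr (.inr ⟨hn, hm, hg, by rw [hC1]; norm_num, by linarith⟩)
    · have hg := G.boundary_genus_of_four hn
      -- With four legs the bound is `ω ≤ 1 - C_∂ - V_2`, so `ω ≥ 0` saturates it and fixes all
      -- three quantities.
      have hC1 : G.boundary.numComponents = 1 := by omega
      have hm : G.numMass = 0 := by omega
      have hd : G.divergenceDegree = 0 := by omega
      rw [hg, hC1, hn, hd, hm] at hformula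
      norm_num at hformula
      exact .inl ⟨hn, hm, hg, by rw [hC1]; norm_num, by linarith⟩
  · rintro (h | h | h | h)
    · rw [v4 h]
    · rw [v2 h]; exact zero_le_one
    · rw [v2m h]
    · rw [v2g h]
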